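/- Let $\mathrm{cell}(n,2)$ be the complex whose $m$-cells are the strings of $n-m$ blocks, separated by bars, of sizes $1$ or $2$, using each label $1,\dots,n$ exactly once. Its boundary map is determined by $\partial(a)=0$, $\partial(a\,b)=a|b-b|a$ and $\partial(g_1|g_2)=\partial g_1|g_2+(-1)^{b(g_1)}g_1|\partial g_2$, where $b(g_1)$ is the number of blocks of $g_1$. Let $\mathrm{FI}_2$ be the category with objects $[n]=\{1,\dots,n\}$, $n\ge 0$, and morphisms the pairs (injection $f$, $2$-colouring of the complement of the image of $f$). The groups $H_1(\mathrm{cell}(n,2);\mathbb{Q})$ form an $\mathrm{FI}_2$-module $H_1(\mathrm{cell}(\bullet,2);\mathbb{Q})$, in which permutations act by relabelling, and the standard inclusions $[n]\hookrightarrow[n+1]$ whose new label $n+1$ has the first, respectively the second, colour act by the high-insertion maps $[\iota_0],[\iota_1]$. On classes of cycles these are $[\iota_0]z=(n+1)|z$ and $[\iota_1]z=z|(n+1)$; equivalently, $[\iota_1]$ inserts the singleton block $n+1$ directly to the right of the barrier (the part of the cycle that is not a string of singletons). Let $z(1\,2)=1\,2+2\,1$, a cycle in $\mathrm{cell}(2,2)$.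 For $n\ge 2$ let $B_n$ be the family of the classes in $H_1(\mathrm{cell}(n,2);\mathbb{Q})$ of the cycles $$i_1|\cdots|i_m|\,i_{m+1}\,i_{m+2}\,|i_{m+3}|\cdots|i_n\;+\;i_1|\cdots|i_m|\,i_{m+2}\,i_{m+1}\,|i_{m+3}|\cdots|i_n ,$$ one for each $0\le m\le n-2$ and each arrangement $i_1,\dots,i_n$ of $1,\dots,n$ with $i_1>\cdots>i_m$, $i_{m+1}<i_{m+2}$ and $i_{m+3}>\cdots>i_n$. For an $S_m$-representation $U_m$ over $\mathbb{Q}$ put $M^{\mathrm{FI}_2}(U_m)=\mathbb{Q}[\mathrm{Hom}_{\mathrm{FI}_2}([m],\bullet)]\otimes_{\mathbb{Q}[S_m]}U_m$, and call an $\mathrm{FI}_2$-module free if it is isomorphic to $\bigoplus_{m\ge 0}M^{\mathrm{FI}_2}(U_m)$ for some $S_m$-representations $U_m$. Proposition. Let $W$ be the smallest $\mathrm{FI}_2$-submodule of $H_1(\mathrm{cell}(\bullet,2);\mathbb{Q})$ that contains the class of $z(1\,2)$, i.e. the $\mathrm{FI}_2$-submodule generated by $z(1\,2)$ under permutations and $[\iota_0],[\iota_1]$.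 Then for every $n\ge 2$ the family $B_n$ is a basis of the degree $n$ part $W_n$ of $W$. Moreover, $W$ is free, and it is isomorphic as an $\mathrm{FI}_2$-module to $M^{\mathrm{FI}_2}(\mathrm{Triv}_2)$, where $\mathrm{Triv}_2$ is the trivial one-dimensional representation of $S_2$ over $\mathbb{Q}$. -/

import Mathlib

open CategoryTheory CategoryTheory.Limits
open scoped TensorProduct

/-! ## The category of finite sets and injections with coloured complement -/

/-- Objects of the skeleton of `FI_d`: one object `[n]` for each natural number `n`. -/
structure FI (d : ℕ) where
  /-- The object `[n]`, with underlying set `Fin n`. -/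
  of ::
  /-- The number of elements. -/
  card : ℕ

namespace FI

/-- A morphism of `FI_d`: an injection `f` together with a `d`-colouring of the complement of the
image of `f`. -/
structure Hom {d : ℕ} (a b : FI d) where
  /-- the injection -/
  f : Fin a.card ↪ Fin b.card
  /-- the colouring -/
  color : {x : Fin b.card // x ∉ Set.range f} → Fin d

namespace Hom

variable {d : ℕ}

theorem ext_of {a b : FI d} {φ ψ : Hom a b} (h : ∀ i, φ.f i = ψ.f i)
    (hc : ∀ x h₁ h₂, φ.color ⟨x, h₁⟩ = ψ.color ⟨x, h₂⟩) : φ = ψ := by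
  obtain ⟨f, c⟩ := φ
  obtain ⟨f', c'⟩ := ψ
  obtain rfl : f = f' := DFunLike.ext _ _ h
  congr 1
  funext x
  exact hc x.1 x.2 x.2

/-- The identity: there is nothing to colour. -/
def id (a : FI d) : Hom a a where
  f := Function.Embedding.refl _
  color x := (x.2 ⟨x.1, rfl⟩).elim

/-- `φ` followed by `ψ`: a point outside the image of `ψ.f` keeps its colour under `ψ`, and a
point `ψ.f y`, with `y` outside the image of `φ.f`, gets the colour of `y` under `φ`. -/
noncomputable def comp {a b c : FI d} (φ : Hom a b) (ψ : Hom b c) : Hom a c where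
  f := φ.f.trans ψ.f
  color x := by
    classical
    exact if h : x.1 ∈ Set.range ψ.f then
      φ.color ⟨h.choose, fun ⟨y, hy⟩ => x.2 ⟨y, by
        rw [Function.Embedding.trans_apply, hy, h.choose_spec]⟩⟩
    else ψ.color ⟨x.1, h⟩

theorem comp_color_apply {a b c : FI d} (φ : Hom a b) (ψ : Hom b c) (y : Fin b.card)
    (h : ψ.f y ∉ Set.range (comp φ ψ).f) (h' : y ∉ Set.range φ.f) :
    (comp φ ψ).color ⟨ψ.f y, h⟩ = φ.color ⟨y, h'⟩ := by
  have hy : ψ.f y ∈ Set.range ψ.f := ⟨y, rfl⟩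
  simp only [comp, dif_pos hy]
  congr 2
  exact ψ.f.injective hy.choose_spec

theorem comp_color_of_notMem {a b c : FI d} (φ : Hom a b) (ψ : Hom b c) (x : Fin c.card)
    (h : x ∉ Set.range (comp φ ψ).f) (h' : x ∉ Set.range ψ.f) :
    (comp φ ψ).color ⟨x, h⟩ = ψ.color ⟨x, h'⟩ := by
  simp only [comp, dif_neg h']

@[simp] theorem comp_f {a b c : FI d} (φ : Hom a b) (ψ : Hom b c) (i) :
    (comp φ ψ).f i = ψ.f (φ.f i) := rfl

end Hom

noncomputable instance (d : ℕ) : Category (FI d) where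
  Hom := Hom
  id := Hom.id
  comp := Hom.comp
  id_comp φ := Hom.ext_of (fun _ => rfl) fun x h₁ h₂ =>
    Hom.comp_color_of_notMem _ _ _ _ h₂
  comp_id φ := Hom.ext_of (fun _ => rfl) fun x h₁ h₂ =>
    Hom.comp_color_apply φ (Hom.id _) x h₁ h₂
  assoc φ ψ χ := Hom.ext_of (fun _ => rfl) fun x h₁ h₂ => by
    by_cases hx : x ∈ Set.range χ.f
    · obtain ⟨y, rfl⟩ := hx
      have hy : y ∉ Set.range (Hom.comp φ ψ).f := fun ⟨z, hz⟩ => h₂ ⟨z, by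
        rw [← hz]; rfl⟩
      rw [Hom.comp_color_apply _ _ _ _ hy]
      by_cases hy' : y ∈ Set.range ψ.f
      · obtain ⟨z, rfl⟩ := hy'
        have hz : z ∉ Set.range φ.f := fun ⟨t, ht⟩ => hy ⟨t, by rw [← ht]; rfl⟩
        rw [Hom.comp_color_apply _ _ _ _ hz]
        exact (Hom.comp_color_apply φ (Hom.comp ψ χ) z h₂ hz).symm
      · rw [Hom.comp_color_of_notMem _ _ _ _ hy']
        have hy'' : χ.f y ∉ Set.range (Hom.comp ψ χ).f := fun ⟨t, ht⟩ =>
          hy' ⟨t, χ.f.injective ht⟩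
        rw [Hom.comp_color_of_notMem φ (Hom.comp ψ χ) _ _ hy'',
          Hom.comp_color_apply _ _ _ _ hy']
    · have hx' : x ∉ Set.range (Hom.comp ψ χ).f := fun ⟨t, ht⟩ => hx ⟨_, ht⟩
      rw [Hom.comp_color_of_notMem _ _ _ _ hx,
        Hom.comp_color_of_notMem φ (Hom.comp ψ χ) _ _ hx',
        Hom.comp_color_of_notMem _ _ _ _ hx]

/-- A permutation of `[m]` as an endomorphism of `[m]` in `FI_d`. -/
def perm (d : ℕ) {m : ℕ} (σ : Equiv.Perm (Fin m)) : (of m : FI d) ⟶ of m where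
  f := σ.toEmbedding
  color x := (x.2 (σ.surjective x.1)).elim

/-- The standard inclusion `[n] ↪ [n + 1]`, with the new largest label coloured `j`. -/
def insertion {d : ℕ} (n : ℕ) (j : Fin d) : (of n : FI d) ⟶ of (n + 1) where
  f := Fin.castSuccEmb
  color _ := j

end FI

/-! ## `FI_d`-modules, submodules and free modules over `ℚ` -/

/-- `FI_d`-modules over `ℚ`. -/
abbrev FIMod (d : ℕ) := FI d ⥤ ModuleCat.{0} ℚ

/-- An `FI_d`-submodule: subspaces closed under all morphisms of `FI_d` (in particular under the
permutations). -/
structure FISubmodule {d : ℕ} (V : FIMod d) where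
  /-- the degree `n` part -/
  obj : ∀ n : ℕ, Submodule ℚ (V.obj (FI.of n))
  map_mem : ∀ {a b : ℕ} (φ : (FI.of a : FI d) ⟶ FI.of b) (x : V.obj (FI.of a)),
    x ∈ obj a → V.map φ x ∈ obj b

namespace FISubmodule

variable {d : ℕ} {V : FIMod d}

/-- The smallest `FI_d`-submodule of `V` that contains the element `x` of degree `m`. -/
def generatedBy (V : FIMod d) (m : ℕ) (x : V.obj (FI.of m)) : FISubmodule V where
  obj n := ⨅ (W : FISubmodule V) (_ : x ∈ W.obj m), W.obj n
  map_mem φ y hy := by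
    simp only [Submodule.mem_iInf] at hy ⊢
    exact fun W hW => W.map_mem φ y (hy W hW)

/-- An `FI_d`-submodule is an `FI_d`-module. -/
def toFIMod (W : FISubmodule V) : FIMod d where
  obj a := ModuleCat.of ℚ (W.obj a.card)
  map {a b} φ := ModuleCat.ofHom ((V.map φ).hom.restrict (W.map_mem (a := a.card) (b := b.card) φ))
  map_id a := by
    ext x
    simp
  map_comp φ ψ := by
    ext x
    simp

end FISubmodule

section Free

variable (d : ℕ) {m : ℕ} {U : Type} [AddCommGroup U] [Module ℚ U]
  (ρ : Representation ℚ (Equiv.Perm (Fin m)) U)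

/-- The relations `φσ ⊗ u = φ ⊗ σu` that turn `ℚ[Hom([m], [n])] ⊗_ℚ U` into the tensor product
over `ℚ[S_m]`. -/
noncomputable def FI.balanced (b : FI d) : Submodule ℚ ((((FI.of m : FI d) ⟶ b) →₀ ℚ) ⊗[ℚ] U) :=
  Submodule.span ℚ {t | ∃ (σ : Equiv.Perm (Fin m)) (φ : (FI.of m : FI d) ⟶ b) (u : U),
    t = Finsupp.single (FI.perm d σ ≫ φ) (1 : ℚ) ⊗ₜ[ℚ] u - Finsupp.single φ (1 : ℚ) ⊗ₜ[ℚ] ρ σ u}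

/-- The action of a morphism `ψ` on `ℚ[Hom([m], -)] ⊗_ℚ U`, by composition. -/
noncomputable def FI.freeMap (U : Type) [AddCommGroup U] [Module ℚ U] {b c : FI d} (ψ : b ⟶ c) :
    (((FI.of m : FI d) ⟶ b) →₀ ℚ) ⊗[ℚ] U →ₗ[ℚ] (((FI.of m : FI d) ⟶ c) →₀ ℚ) ⊗[ℚ] U :=
  LinearMap.rTensor U (Finsupp.lmapDomain ℚ ℚ (fun φ => φ ≫ ψ))

theorem FI.balanced_le {b c : FI d} (ψ : b ⟶ c) :
    FI.balanced d ρ b ≤ (FI.balanced d ρ c).comap (FI.freeMap d U ψ) := by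
  refine Submodule.span_le.2 ?_
  rintro _ ⟨σ, φ, u, rfl⟩
  refine Submodule.subset_span ⟨σ, φ ≫ ψ, u, ?_⟩
  simp [FI.freeMap, Finsupp.mapDomain_single]

/-- The free `FI_d`-module relative to the representation `ρ` of `S_m` on `U`,
`M(U) = ℚ[Hom([m], -)] ⊗_{ℚ[S_m]} U`. -/
noncomputable def FI.free : FIMod d where
  obj b := ModuleCat.of ℚ (((((FI.of m : FI d) ⟶ b) →₀ ℚ) ⊗[ℚ] U) ⧸ FI.balanced d ρ b)
  map ψ := ModuleCat.ofHom (Submodule.mapQ _ _ (FI.freeMap d U ψ) (FI.balanced_le d ρ ψ))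
  map_id b := by
    ext
    simp [FI.freeMap, Finsupp.mapDomain_single]
  map_comp ψ χ := by
    ext
    simp [FI.freeMap, Finsupp.mapDomain_single]

end Free

/-- An `FI_d`-module is free if it is isomorphic to `⨁_m M(U_m)` for some sequence of
representations `U_m` of the symmetric groups `S_m`. -/
def FIMod.IsFree {d : ℕ} (V : FIMod d) : Prop :=
  ∃ (U : ℕ → ModuleCat.{0} ℚ) (ρ : ∀ m, Representation ℚ (Equiv.Perm (Fin m)) (U m)),
    Nonempty (V ≅ ∐ fun m => FI.free d (ρ m))

/-! ## The cellular chain complex of `cell(n, w)` -/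

namespace Strip

/-- Formal `ℚ`-linear combinations of strings of blocks of labels from `α`. A string of blocks
`α₁|α₂|⋯|α_r` is a list of lists. -/
abbrev Chain (α : Type) := List (List α) →₀ ℚ

variable {α β : Type}

/-- All ways of writing a block as a shuffle of two blocks `A`, `B` (possibly empty), each with the
sign of the permutation that takes the block to the concatenation `A B`. -/
def unshuffles : List α → List (ℚ × List α × List α)
  | [] => [(1, [], [])]
  | a :: l => (unshuffles l).flatMap fun t =>
      [(t.1, a :: t.2.1, t.2.2), (t.1 * (-1) ^ t.2.1.length, t.2.1, a :: t.2.2)]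

/-- The boundary of a single block: the signed sum of all `A|B` with `A`, `B` nonempty of which the
block is a shuffle. -/
noncomputable def blockBoundary (b : List α) : Chain α :=
  (((unshuffles b).filter fun t => !t.2.1.isEmpty && !t.2.2.isEmpty).map fun t =>
    Finsupp.single [t.2.1, t.2.2] t.1).sum

/-- Concatenation `s|x|t` of a chain with strings of blocks on both sides. -/
noncomputable def concat (s t : List (List α)) : Chain α →ₗ[ℚ] Chain α :=
  Finsupp.lmapDomain ℚ ℚ fun u => s ++ u ++ t

/-- The boundary of a string of blocks, by the rule
`∂(g₁|g₂) = ∂g₁|g₂ + (-1) ^ (number of blocks of g₁) g₁|∂g₂` with `g₁` a single block. -/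
noncomputable def symbolBoundary : List (List α) → Chain α
  | [] => 0
  | b :: s => concat [] s (blockBoundary b) - concat [b] [] (symbolBoundary s)

/-- The boundary map. -/
noncomputable def boundary : Chain α →ₗ[ℚ] Chain α :=
  Finsupp.lsum ℚ fun s => LinearMap.toSpanSingleton ℚ _ (symbolBoundary s)

/-- `s` is a symbol on `n` labels whose blocks are nonempty and have at most `w` elements, and which
has `n - m` blocks, i.e. `s` represents an `m`-cell of `cell(n, w)`. -/
structure IsCell (n w m : ℕ) (s : List (List (Fin n))) : Prop where
  perm : s.flatten.Perm (List.finRange n)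
  ne_nil : ∀ b ∈ s, b ≠ []
  length_le : ∀ b ∈ s, b.length ≤ w
  dim : s.length + m = n

/-- The group of cellular `m`-chains of `cell(n, w)`. -/
def chains (n w m : ℕ) : Submodule ℚ (Chain (Fin n)) :=
  Finsupp.supported ℚ ℚ {s | IsCell n w m s}

/-- The `m`-cycles of `cell(n, w)`. -/
noncomputable def cycles (n w m : ℕ) : Submodule ℚ (Chain (Fin n)) :=
  chains n w m ⊓ LinearMap.ker boundary

/-- The `m`-boundaries of `cell(n, w)`. -/
noncomputable def boundaries (n w m : ℕ) : Submodule ℚ (Chain (Fin n)) :=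
  (chains n w (m + 1)).map boundary

/-- The homology group `H_m(cell(n, w); ℚ)`. -/
abbrev Homology (n w m : ℕ) : Type :=
  cycles n w m ⧸ (boundaries n w m).comap (cycles n w m).subtype


/-! ### `cell(n, w)` is a chain complex -/

@[simp] theorem concat_single (s t u : List (List α)) (a : ℚ) :
    concat s t (Finsupp.single u a) = Finsupp.single (s ++ u ++ t) a := by
  simp [concat, Finsupp.mapDomain_single]

theorem concat_concat (s t s' t' : List (List α)) (x : Chain α) :
    concat s t (concat s' t' x) = concat (s ++ s') (t' ++ t) x := by
  induction x using Finsupp.induction_linear with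
  | zero => simp
  | add x y hx hy => simp [hx, hy]
  | single u a => simp

@[simp] theorem concat_nil (x : Chain α) : concat [] [] x = x := by
  induction x using Finsupp.induction_linear with
  | zero => simp
  | add x y hx hy => simp [hx, hy]
  | single u a => simp

@[simp] theorem boundary_single (s : List (List α)) (a : ℚ) :
    boundary (Finsupp.single s a) = a • symbolBoundary s := by
  simp [boundary]

@[simp] theorem blockBoundary_singleton (a : α) : blockBoundary [a] = 0 := by
  simp [blockBoundary, unshuffles]

@[simp] theorem blockBoundary_pair (a b : α) :
    blockBoundary [a, b] = Finsupp.single [[a], [b]] 1 - Finsupp.single [[b], [a]] 1 := by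
  simp [blockBoundary, unshuffles, sub_eq_add_neg, add_comm]

theorem symbolBoundary_append (s t : List (List α)) :
    symbolBoundary (s ++ t) =
      concat [] t (symbolBoundary s) + (-1 : ℚ) ^ s.length • concat s [] (symbolBoundary t) := by
  induction s with
  | nil => simp [symbolBoundary]
  | cons b s ih =>
    simp [symbolBoundary, ih, concat_concat, pow_succ, sub_eq_add_neg, add_assoc, add_comm]

/-- The string of singleton blocks with the given labels. -/
def singles (l : List α) : List (List α) := l.map fun a => [a]

@[simp] theorem symbolBoundary_singles (l : List α) : symbolBoundary (singles l) = 0 := by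
  induction l with
  | nil => rfl
  | cons a l ih =>
    rw [show singles (a :: l) = [a] :: singles l from rfl, symbolBoundary, ih]
    simp

theorem boundary_concat_singles (p q : List α) (x : Chain α) :
    boundary (concat (singles p) (singles q) x) =
      (-1 : ℚ) ^ p.length • concat (singles p) (singles q) (boundary x) := by
  induction x using Finsupp.induction_linear with
  | zero => simp
  | add x y hx hy => simp [hx, hy]
  | single u a =>
    rw [concat_single, boundary_single, boundary_single, symbolBoundary_append,
      symbolBoundary_append, symbolBoundary_singles, symbolBoundary_singles]
    simp [concat_concat, smul_comm a, singles]

open scoped Classical in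
/-- Removing the strings with an empty block. -/
noncomputable def dropEmpty : Chain α →ₗ[ℚ] Chain α :=
  Finsupp.lsum ℚ fun s => if [] ∈ s then 0 else Finsupp.lsingle s

open scoped Classical in
theorem dropEmpty_single (s : List (List α)) (a : ℚ) :
    dropEmpty (Finsupp.single s a) = if [] ∈ s then 0 else Finsupp.single s a := by
  simp only [dropEmpty, Finsupp.lsum_single]
  split_ifs <;> simp

/-- The signed sum over all unshuffles of a block, empty parts allowed. -/
noncomputable def coproduct (b : List α) : Chain α :=
  ((unshuffles b).map fun t => Finsupp.single [t.2.1, t.2.2] t.1).sum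

theorem dropEmpty_sum (L : List (Chain α)) : dropEmpty L.sum = (L.map dropEmpty).sum :=
  map_list_sum _ _

theorem blockBoundary_eq (b : List α) : blockBoundary b = dropEmpty (coproduct b) := by
  rw [blockBoundary, coproduct, dropEmpty_sum]
  induction unshuffles b with
  | nil => simp
  | cons t L ih =>
    obtain ⟨ε, A, B⟩ := t
    rw [List.filter_cons]
    rcases A with _ | ⟨a, A⟩ <;> rcases B with _ | ⟨b, B⟩ <;>
      simp_all [dropEmpty_single]

/-- Attaching a label to the front of each of the three blocks of a string of three blocks. -/
noncomputable def attach (a : α) : Chain α →ₗ[ℚ] Chain α :=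
  Finsupp.lsum ℚ fun s => match s with
    | [P, Q, R] => Finsupp.lsingle [a :: P, Q, R] +
        (-1 : ℚ) ^ P.length • Finsupp.lsingle [P, a :: Q, R] +
        (-1 : ℚ) ^ (P.length + Q.length) • Finsupp.lsingle [P, Q, a :: R]
    | _ => 0

theorem attach_single (a : α) (P Q R : List α) (c : ℚ) :
    attach a (Finsupp.single [P, Q, R] c) = Finsupp.single [a :: P, Q, R] c +
        (-1 : ℚ) ^ P.length • Finsupp.single [P, a :: Q, R] c +
        (-1 : ℚ) ^ (P.length + Q.length) • Finsupp.single [P, Q, a :: R] c := by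
  simp [attach]

theorem perm_of_mem_unshuffles {b : List α} : ∀ {t}, t ∈ unshuffles b →
    (t.2.1 ++ t.2.2).Perm b := by
  induction b with
  | nil => simp [unshuffles]
  | cons a l ih =>
    intro t ht
    simp only [unshuffles, List.mem_flatMap, List.mem_cons, List.not_mem_nil, or_false] at ht
    obtain ⟨t, ht, rfl | rfl⟩ := ht
    · simpa using ih ht
    · exact List.perm_middle.trans ((ih ht).cons a)

theorem coproduct_cons (a : α) (l : List α) :
    coproduct (a :: l) = ((unshuffles l).map fun t =>
      Finsupp.single [a :: t.2.1, t.2.2] t.1 +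
        Finsupp.single [t.2.1, a :: t.2.2] (t.1 * (-1) ^ t.2.1.length)).sum := by
  rw [coproduct, unshuffles]
  induction unshuffles l with
  | nil => simp
  | cons t L ih => simp [ih, add_assoc]

/-- A sum over unshuffles of a label attached to a block. -/
theorem sum_unshuffles_cons {M : Type*} [AddCommMonoid M] (a : α) (l : List α)
    (F : ℚ × List α × List α → M) :
    ((unshuffles (a :: l)).map F).sum = ((unshuffles l).map fun t =>
      F (t.1, a :: t.2.1, t.2.2) +
        F (t.1 * (-1) ^ t.2.1.length, t.2.1, a :: t.2.2)).sum := by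
  rw [unshuffles]
  induction unshuffles l with
  | nil => simp
  | cons t L ih => simp [ih, add_assoc]

theorem attach_left (a : α) (A B : List α) :
    attach a (concat [] [B] (coproduct A)) = concat [] [B] (coproduct (a :: A)) +
      (-1 : ℚ) ^ A.length • concat [] [a :: B] (coproduct A) := by
  rw [coproduct_cons, coproduct]
  have : ∀ L : List (ℚ × List α × List α), (∀ t ∈ L, (t.2.1 ++ t.2.2).Perm A) →
    attach a (concat [] [B] (L.map fun t => Finsupp.single [t.2.1, t.2.2] t.1).sum) =
    concat [] [B] (L.map fun t => Finsupp.single [a :: t.2.1, t.2.2] t.1 +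
        Finsupp.single [t.2.1, a :: t.2.2] (t.1 * (-1) ^ t.2.1.length)).sum +
      (-1 : ℚ) ^ A.length • concat [] [a :: B]
        (L.map fun t => Finsupp.single [t.2.1, t.2.2] t.1).sum := by
    intro L
    induction L with
    | nil => simp
    | cons t L ih =>
      intro h
      have h1 := (h t (by simp)).length_eq
      rw [List.length_append] at h1
      simp only [List.map_cons, List.sum_cons, map_add,
        ih fun t ht => h t (List.mem_cons_of_mem _ ht), concat_single, List.nil_append,
        List.cons_append, attach_single, h1, smul_add]
      simp only [Finsupp.smul_single, smul_eq_mul, mul_comm t.1]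
      abel
  exact this _ fun t ht => perm_of_mem_unshuffles ht

theorem attach_right (a : α) (A B : List α) :
    attach a (concat [A] [] (coproduct B)) = concat [a :: A] [] (coproduct B) +
      (-1 : ℚ) ^ A.length • concat [A] [] (coproduct (a :: B)) := by
  rw [coproduct_cons, coproduct]
  induction unshuffles B with
  | nil => simp
  | cons t L ih =>
    simp only [List.map_cons, List.sum_cons, map_add, ih, concat_single, List.nil_append,
      List.cons_append, attach_single, smul_add, List.append_nil]
    simp only [Finsupp.smul_single, smul_eq_mul, mul_comm t.1, pow_add, mul_assoc]
    abel

theorem coproduct_coassoc (b : List α) :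
    ((unshuffles b).map fun t => t.1 • concat [] [t.2.2] (coproduct t.2.1)).sum =
      ((unshuffles b).map fun t => t.1 • concat [t.2.1] [] (coproduct t.2.2)).sum := by
  induction b with
  | nil => simp [unshuffles, coproduct]
  | cons a l ih =>
    rw [sum_unshuffles_cons, sum_unshuffles_cons]
    have h := congrArg (attach a) ih
    simp only [map_list_sum, List.map_map, Function.comp_def, map_smul, attach_left,
      attach_right] at h
    simpa only [smul_add, smul_smul] using h

theorem dropEmpty_concat (s t : List (List α)) (x : Chain α) (h : [] ∉ s) (h' : [] ∉ t) :
    dropEmpty (concat s t x) = concat s t (dropEmpty x) := by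
  induction x using Finsupp.induction_linear with
  | zero => simp
  | add x y hx hy => simp [hx, hy]
  | single u a =>
    rw [concat_single, dropEmpty_single, dropEmpty_single]
    by_cases hu : [] ∈ u <;> simp [hu, h, h']

theorem dropEmpty_concat_of_mem (s t : List (List α)) (x : Chain α) (h : [] ∈ s ++ t) :
    dropEmpty (concat s t x) = 0 := by
  induction x using Finsupp.induction_linear with
  | zero => simp
  | add x y hx hy => simp [hx, hy]
  | single u a =>
    rw [concat_single, dropEmpty_single, if_pos]
    simp only [List.mem_append] at h ⊢
    tauto

theorem blockBoundary_nil : blockBoundary ([] : List α) = 0 := by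
  simp [blockBoundary, unshuffles]

theorem boundary_blockBoundary (b : List α) : boundary (blockBoundary b) = 0 := by
  have key := congrArg dropEmpty (coproduct_coassoc b)
  rw [dropEmpty_sum, dropEmpty_sum, List.map_map, List.map_map, ← sub_eq_zero] at key
  rw [← key, blockBoundary]
  generalize unshuffles b = L
  clear key
  induction L with
  | nil => simp
  | cons t L ih =>
    obtain ⟨ε, A, B⟩ := t
    simp only [List.map_cons, List.sum_cons, Function.comp, map_smul]
    rw [add_sub_add_comm, ← ih, List.filter_cons]
    by_cases hA : A = []
    · subst hA
      rw [dropEmpty_concat_of_mem [[]] [] _ (by simp)]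
      by_cases hB : B = []
      · subst hB
        rw [dropEmpty_concat_of_mem [] [[]] _ (by simp)]
        simp
      · rw [dropEmpty_concat [] [B] _ (by simp) (by simpa using Ne.symm hB), ← blockBoundary_eq,
          blockBoundary_nil]
        simp
    · by_cases hB : B = []
      · subst hB
        rw [dropEmpty_concat_of_mem [] [[]] _ (by simp),
          dropEmpty_concat [A] [] _ (by simpa using Ne.symm hA) (by simp), ← blockBoundary_eq,
          blockBoundary_nil]
        simp
      · rw [dropEmpty_concat [] [B] _ (by simp) (by simpa using Ne.symm hB),
          dropEmpty_concat [A] [] _ (by simpa using Ne.symm hA) (by simp), ← blockBoundary_eq,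
          ← blockBoundary_eq]
        simp [hA, hB, symbolBoundary, smul_sub]

/-- Concatenation of chains. -/
noncomputable def mul : Chain α →ₗ[ℚ] Chain α →ₗ[ℚ] Chain α :=
  Finsupp.lsum ℚ fun s => LinearMap.toSpanSingleton ℚ (Chain α →ₗ[ℚ] Chain α) (concat s [])

@[simp] theorem mul_single_left (s : List (List α)) (a : ℚ) (y : Chain α) :
    mul (Finsupp.single s a) y = a • concat s [] y := by
  simp [mul]

theorem mul_single_right (x : Chain α) (t : List (List α)) (a : ℚ) :
    mul x (Finsupp.single t a) = a • concat [] t x := by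
  induction x using Finsupp.induction_linear with
  | zero => simp
  | add x y hx hy => simp [hx, hy]
  | single u b => simp [mul_comm a]

/-- Multiplying each string by `(-1) ^ (number of blocks)`. -/
noncomputable def blockSign : Chain α →ₗ[ℚ] Chain α :=
  Finsupp.lsum ℚ fun s => (-1 : ℚ) ^ s.length • Finsupp.lsingle s

@[simp] theorem blockSign_single (s : List (List α)) (a : ℚ) :
    blockSign (Finsupp.single s a) = (-1 : ℚ) ^ s.length • Finsupp.single s a := by
  simp [blockSign]

theorem blockSign_eq {x : Chain α} {k : ℕ} (h : ∀ s ∈ x.support, s.length = k) :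
    blockSign x = (-1 : ℚ) ^ k • x := by
  conv_rhs => rw [← Finsupp.sum_single x]
  rw [blockSign, Finsupp.lsum_apply, Finsupp.smul_sum]
  refine Finsupp.sum_congr fun s hs => ?_
  rw [h s hs]
  rfl

/-- `∂(g₁|g₂) = ∂g₁|g₂ + (-1) ^ (number of blocks of g₁) g₁|∂g₂`. -/
theorem boundary_mul (x y : Chain α) :
    boundary (mul x y) = mul (boundary x) y + mul (blockSign x) (boundary y) := by
  induction x using Finsupp.induction_linear with
  | zero => simp
  | add x z hx hz => simp only [map_add, LinearMap.add_apply, hx, hz]; abel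
  | single s b =>
    induction y using Finsupp.induction_linear with
    | zero => simp
    | add x y hx hy => simp only [map_add, hx, hy]; abel
    | single u a =>
      simp only [map_smul, LinearMap.smul_apply, mul_single_right, boundary_single,
        mul_single_left, concat_single, blockSign_single, List.nil_append]
      rw [symbolBoundary_append]
      simp only [smul_add, smul_smul]
      congr 2 <;> ring

theorem boundary_mul_blockBoundary (b : List α) (y : Chain α) :
    boundary (mul (blockBoundary b) y) = mul (blockBoundary b) (boundary y) := by
  have h : blockSign (blockBoundary b) = blockBoundary b := by
    rw [blockBoundary, map_list_sum, List.map_map]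
    congr 2
    funext t
    simp
  rw [boundary_mul, boundary_blockBoundary, h]
  simp

theorem boundary_concat_block (b : List α) (y : Chain α) :
    boundary (concat [b] [] y) = mul (blockBoundary b) y - concat [b] [] (boundary y) := by
  induction y using Finsupp.induction_linear with
  | zero => simp
  | add x y hx hy => simp only [map_add, hx, hy]; abel
  | single u a =>
    rw [mul_single_right]
    simp [symbolBoundary, smul_sub]

theorem boundary_symbolBoundary (s : List (List α)) : boundary (symbolBoundary s) = 0 := by
  induction s with
  | nil => simp [symbolBoundary]
  | cons b s ih =>
    rw [symbolBoundary, map_sub, boundary_concat_block, ih,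
      ← one_smul ℚ (concat [] s (blockBoundary b)), ← mul_single_right,
      boundary_mul_blockBoundary]
    simp

/-- `∂ ∘ ∂ = 0`. -/
theorem boundary_boundary (x : Chain α) : boundary (boundary x) = 0 := by
  induction x using Finsupp.induction_linear with
  | zero => simp
  | add x y hx hy => simp [hx, hy]
  | single u a => simp [boundary_symbolBoundary]

/-- Every term in the boundary of `s` is obtained from `s` by cutting one block. -/
theorem mem_support_symbolBoundary {s u : List (List α)} (h : u ∈ (symbolBoundary s).support) :
    u.flatten.Perm s.flatten ∧ u.length = s.length + 1 ∧
      ((∀ b ∈ s, b ≠ []) → ∀ b ∈ u, b ≠ []) ∧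
      ∀ w, (∀ b ∈ s, b.length ≤ w) → ∀ b ∈ u, b.length ≤ w := by
  classical
  induction s generalizing u with
  | nil => simp [symbolBoundary] at h
  | cons b s ih =>
    rw [symbolBoundary] at h
    rcases Finset.mem_union.1 (Finsupp.support_sub h) with h | h
    · obtain ⟨v, hv, rfl⟩ := Finset.mem_image.1 (Finsupp.mapDomain_support h)
      have key : ∀ L : List (ℚ × List α × List α), (∀ t ∈ L, t ∈ unshuffles b) →
          v ∈ ((L.filter fun t => !t.2.1.isEmpty && !t.2.2.isEmpty).map fun t =>
            Finsupp.single [t.2.1, t.2.2] t.1).sum.support →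
          ∃ A B : List α, A ≠ [] ∧ B ≠ [] ∧ (A ++ B).Perm b ∧ v = [A, B] := by
        intro L
        induction L with
        | nil => simp
        | cons t L ihL =>
          intro hL hv
          rw [List.filter_cons] at hv
          split_ifs at hv with ht
          · rw [List.map_cons, List.sum_cons] at hv
            rcases Finset.mem_union.1 (Finsupp.support_add hv) with hv | hv
            · have := Finsupp.support_single_subset hv
              rw [Finset.mem_singleton] at this
              exact ⟨t.2.1, t.2.2, by simp_all, by simp_all,
                perm_of_mem_unshuffles (hL t (by simp)), this⟩
            · exact ihL (fun t ht => hL t (by simp [ht])) hv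
          · exact ihL (fun t ht => hL t (by simp [ht])) hv
      obtain ⟨A, B, hA, hB, hp, rfl⟩ := key _ (fun _ h => h) hv
      have hl := hp.length_eq
      rw [List.length_append] at hl
      refine ⟨by simpa using hp.append_right s.flatten, by simp, fun h c hc => ?_,
        fun w h c hc => ?_⟩
      · simp only [List.nil_append, List.cons_append, List.mem_cons] at hc
        rcases hc with rfl | rfl | hc
        exacts [hA, hB, h c (by simp [hc])]
      · have hb := h b (by simp)
        simp only [List.nil_append, List.cons_append, List.mem_cons] at hc
        rcases hc with rfl | rfl | hc
        exacts [by omega, by omega, h c (by simp [hc])]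
    · obtain ⟨v, hv, rfl⟩ := Finset.mem_image.1 (Finsupp.mapDomain_support h)
      obtain ⟨h1, h2, h3, h4⟩ := ih hv
      refine ⟨by simpa using h1.append_left b, by simp [h2], fun h c hc => ?_,
        fun w h c hc => ?_⟩
      · simp only [List.append_nil, List.cons_append, List.nil_append, List.mem_cons] at hc
        rcases hc with rfl | hc
        exacts [h _ (by simp), h3 (fun b hb => h b (by simp [hb])) c hc]
      · simp only [List.append_nil, List.cons_append, List.nil_append, List.mem_cons] at hc
        rcases hc with rfl | hc
        exacts [h _ (by simp), h4 w (fun b hb => h b (by simp [hb])) c hc]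

/-- The boundary map sends `(m + 1)`-chains of `cell(n, w)` to `m`-chains. -/
theorem boundary_mem_chains {n w m : ℕ} {x : Chain (Fin n)} (hx : x ∈ chains n w (m + 1)) :
    boundary x ∈ chains n w m := by
  rw [boundary, Finsupp.lsum_apply]
  refine Submodule.sum_mem _ fun s hs => Submodule.smul_mem _ _ ?_
  have hc : IsCell n w (m + 1) s := hx hs
  intro u hu
  obtain ⟨h1, h2, h3, h4⟩ := mem_support_symbolBoundary hu
  exact ⟨h1.trans hc.perm, h3 hc.ne_nil, h4 w hc.length_le, by have := hc.dim; omega⟩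

theorem boundaries_le_cycles (n w m : ℕ) : boundaries n w m ≤ cycles n w m := by
  rintro _ ⟨x, hx, rfl⟩
  exact ⟨boundary_mem_chains hx, boundary_boundary x⟩

/-! ### Relabelling, and moving singleton blocks past each other -/

/-- Applying a map to all labels. -/
noncomputable def relabel (f : α → β) : Chain α →ₗ[ℚ] Chain β :=
  Finsupp.lmapDomain ℚ ℚ (List.map (List.map f))

@[simp] theorem relabel_single (f : α → β) (s : List (List α)) (a : ℚ) :
    relabel f (Finsupp.single s a) = Finsupp.single (s.map (List.map f)) a := by
  simp [relabel, Finsupp.mapDomain_single]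

theorem relabel_concat (f : α → β) (s t : List (List α)) (x : Chain α) :
    relabel f (concat s t x) = concat (s.map (List.map f)) (t.map (List.map f)) (relabel f x) := by
  induction x using Finsupp.induction_linear with
  | zero => simp
  | add x y hx hy => simp [hx, hy]
  | single u a => simp

theorem unshuffles_map (f : α → β) (b : List α) :
    unshuffles (b.map f) = (unshuffles b).map fun t => (t.1, t.2.1.map f, t.2.2.map f) := by
  induction b with
  | nil => simp [unshuffles]
  | cons a l ih => simp [unshuffles, ih, List.flatMap_map, List.map_flatMap]

theorem relabel_blockBoundary (f : α → β) (b : List α) :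
    relabel f (blockBoundary b) = blockBoundary (b.map f) := by
  rw [blockBoundary, blockBoundary, unshuffles_map, List.filter_map, map_list_sum, List.map_map,
    List.map_map]
  congr 1
  have : (fun t : ℚ × List β × List β => !t.2.1.isEmpty && !t.2.2.isEmpty) ∘
      (fun t : ℚ × List α × List α => (t.1, t.2.1.map f, t.2.2.map f)) =
      fun t => !t.2.1.isEmpty && !t.2.2.isEmpty := by
    funext t; simp
  rw [this]
  congr 1
  funext t
  simp

theorem boundary_relabel (f : α → β) (x : Chain α) :
    boundary (relabel f x) = relabel f (boundary x) := by
  induction x using Finsupp.induction_linear with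
  | zero => simp
  | add x y hx hy => simp [hx, hy]
  | single u a =>
    rw [relabel_single, boundary_single, boundary_single, map_smul]
    congr 1
    induction u with
    | nil => simp [symbolBoundary]
    | cons b s ih =>
      rw [List.map_cons, symbolBoundary, symbolBoundary, map_sub, relabel_concat, relabel_concat,
        ih, relabel_blockBoundary]
      simp

@[simp] theorem singles_append (l l' : List α) : singles (l ++ l') = singles l ++ singles l' :=
  List.map_append

@[simp] theorem singles_cons (a : α) (l : List α) : singles (a :: l) = [a] :: singles l := rfl

@[simp] theorem singles_nil : singles ([] : List α) = [] := rfl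

@[simp] theorem length_singles (l : List α) : (singles l).length = l.length := List.length_map _

@[simp] theorem flatten_singles (l : List α) : (singles l).flatten = l := by
  induction l with
  | nil => rfl
  | cons a l ih => simp [ih]

@[simp] theorem map_singles (f : α → β) (l : List α) :
    (singles l).map (List.map f) = singles (l.map f) := by
  simp [singles]

theorem singles_perm {l l' : List α} (h : l.Perm l') : (singles l).Perm (singles l') := h.map _

theorem IsCell.of_perm {n w m : ℕ} {s t : List (List (Fin n))} (hs : IsCell n w m s)
    (h : s.Perm t) : IsCell n w m t :=
  ⟨h.symm.flatten.trans hs.perm, fun b hb => hs.ne_nil b (h.mem_iff.2 hb),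
    fun b hb => hs.length_le b (h.mem_iff.2 hb), by rw [← h.length_eq]; exact hs.dim⟩

theorem IsCell.merge {n w m : ℕ} (hw : 2 ≤ w) {s t : List (List (Fin n))} {a b : Fin n}
    (hs : IsCell n w m (s ++ [a] :: [b] :: t)) : IsCell n w (m + 1) (s ++ [a, b] :: t) := by
  obtain ⟨h1, h2, h3, h4⟩ := hs
  refine ⟨by simpa using h1, fun c hc => ?_, fun c hc => ?_, by simp at h4 ⊢; omega⟩
  · simp only [List.mem_append, List.mem_cons] at hc
    rcases hc with hc | rfl | hc
    exacts [h2 c (by simp [hc]), by simp, h2 c (by simp [hc])]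
  · simp only [List.mem_append, List.mem_cons] at hc
    rcases hc with hc | rfl | hc
    exacts [h3 c (by simp [hc]), by simpa using hw, h3 c (by simp [hc])]

theorem concat_mem_chains {n w m : ℕ} {s t : List (List (Fin n))} {x : Chain (Fin n)}
    (h : ∀ u ∈ x.support, IsCell n w m (s ++ u ++ t)) : concat s t x ∈ chains n w m := by
  classical
  intro v hv
  obtain ⟨u, hu, rfl⟩ := Finset.mem_image.1 (Finsupp.mapDomain_support hv)
  exact h u hu

theorem mem_support_concat {s t v : List (List α)} {x : Chain α}
    (hv : v ∈ (concat s t x).support) : ∃ u ∈ x.support, v = s ++ u ++ t := by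
  classical
  obtain ⟨u, hu, rfl⟩ := Finset.mem_image.1 (Finsupp.mapDomain_support hv)
  exact ⟨u, hu, rfl⟩

theorem swap_left {n w m : ℕ} (hw : 2 ≤ w) (p q : List (Fin n)) (a b : Fin n)
    {y : Chain (Fin n)} (hy : boundary y = 0)
    (h : ∀ u ∈ y.support, IsCell n w m (singles (p ++ a :: b :: q) ++ u)) :
    concat (singles (p ++ a :: b :: q)) [] y - concat (singles (p ++ b :: a :: q)) [] y ∈
      boundaries n w m := by
  refine ⟨(-1 : ℚ) ^ p.length • concat (singles p ++ [a, b] :: singles q) [] y,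
    Submodule.smul_mem _ _ (concat_mem_chains fun u hu => ?_), ?_⟩
  · have := h u hu
    simp only [singles_append, singles_cons, List.append_assoc, List.cons_append] at this
    simpa using this.merge hw
  · rw [map_smul, ← one_smul ℚ (concat _ [] y), ← mul_single_left, boundary_mul, hy,
      boundary_single, symbolBoundary_append, symbolBoundary, symbolBoundary_singles,
      symbolBoundary_singles, blockBoundary_pair]
    simp [smul_smul, ← pow_add, ← two_mul]

theorem swap_right {n w m : ℕ} (hw : 2 ≤ w) (p q : List (Fin n)) (a b : Fin n)
    {y : Chain (Fin n)} (hy : boundary y = 0)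
    (h : ∀ u ∈ y.support, IsCell n w m (u ++ singles (p ++ a :: b :: q))) :
    concat [] (singles (p ++ a :: b :: q)) y - concat [] (singles (p ++ b :: a :: q)) y ∈
      boundaries n w m := by
  obtain ⟨k, hk⟩ : ∃ k, ∀ u ∈ y.support, u.length = k := by
    refine ⟨n - m - (p ++ a :: b :: q).length, fun u hu => ?_⟩
    have := (h u hu).dim
    rw [List.length_append, length_singles] at this
    omega
  refine ⟨(-1 : ℚ) ^ (k + p.length) • concat [] (singles p ++ [a, b] :: singles q) y,
    Submodule.smul_mem _ _ (concat_mem_chains fun u hu => ?_), ?_⟩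
  · have := h u hu
    simp only [singles_append, singles_cons, ← List.append_assoc] at this
    simpa using this.merge hw
  · rw [map_smul, ← one_smul ℚ (concat [] _ y), ← mul_single_right, boundary_mul, hy,
      boundary_single, symbolBoundary_append, symbolBoundary, symbolBoundary_singles,
      symbolBoundary_singles, blockBoundary_pair, blockSign_eq hk]
    have : Even (k + p.length + (p.length + k)) := ⟨k + p.length, by ring⟩
    simp [smul_smul, ← pow_add, mul_single_right, this.neg_one_pow]

theorem perm_left {n w m : ℕ} (hw : 2 ≤ w) {q q' : List (Fin n)} (hq : q.Perm q') :
    ∀ (p : List (Fin n)) {y : Chain (Fin n)}, boundary y = 0 →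
    (∀ u ∈ y.support, IsCell n w m (singles (p ++ q) ++ u)) →
    concat (singles (p ++ q)) [] y - concat (singles (p ++ q')) [] y ∈ boundaries n w m := by
  induction hq with
  | nil => intro p y _ _; simp
  | cons a _ ih =>
    intro p y hy h
    simpa using ih (p ++ [a]) hy (by simpa using h)
  | swap a b l => intro p y hy h; exact swap_left hw p l b a hy h
  | trans h₁ h₂ ih₁ ih₂ =>
    intro p y hy h
    have := Submodule.add_mem _ (ih₁ p hy h) (ih₂ p hy fun u hu =>
      (h u hu).of_perm ((singles_perm (h₁.append_left p)).append_right u))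
    simpa using this

theorem perm_right {n w m : ℕ} (hw : 2 ≤ w) {q q' : List (Fin n)} (hq : q.Perm q') :
    ∀ (p : List (Fin n)) {y : Chain (Fin n)}, boundary y = 0 →
    (∀ u ∈ y.support, IsCell n w m (u ++ singles (p ++ q))) →
    concat [] (singles (p ++ q)) y - concat [] (singles (p ++ q')) y ∈ boundaries n w m := by
  induction hq with
  | nil => intro p y _ _; simp
  | cons a _ ih =>
    intro p y hy h
    simpa using ih (p ++ [a]) hy (by simpa using h)
  | swap a b l => intro p y hy h; exact swap_right hw p l b a hy h
  | trans h₁ h₂ ih₁ ih₂ =>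
    intro p y hy h
    have := Submodule.add_mem _ (ih₁ p hy h) (ih₂ p hy fun u hu =>
      (h u hu).of_perm ((singles_perm (h₁.append_left p)).append_left u))
    simpa using this

/-- Permuting the singletons on the left and on the right of a cycle does not change the homology
class. -/
theorem concat_perm {n w m : ℕ} (hw : 2 ≤ w) {p p' q q' : List (Fin n)} (hp : p.Perm p')
    (hq : q.Perm q') {x : Chain (Fin n)} (hx : boundary x = 0)
    (h : ∀ u ∈ x.support, IsCell n w m (singles p ++ u ++ singles q)) :
    concat (singles p) (singles q) x - concat (singles p') (singles q') x ∈
      boundaries n w m := by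
  have h1 := perm_left (m := m) hw hp [] (y := concat [] (singles q) x)
    (by simpa [hx] using boundary_concat_singles [] q x) (by
      intro u hu
      obtain ⟨v, hv, rfl⟩ := mem_support_concat hu
      simpa using h v hv)
  have h2 := perm_right (m := m) hw hq [] (y := concat (singles p') [] x)
    (by simpa [hx] using boundary_concat_singles p' [] x) (by
      intro u hu
      obtain ⟨v, hv, rfl⟩ := mem_support_concat hu
      simpa using (h v hv).of_perm (((singles_perm hp).append_right v).append_right _))
  simpa [concat_concat] using Submodule.add_mem _ h1 h2

/-! ### `H_1(cell(•, 2); ℚ)` as an `FI_2`-module -/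

open scoped Classical in
/-- The labels outside the image of `φ` that have colour `c`, in decreasing order. -/
noncomputable def colored {d : ℕ} {a b : FI d} (φ : a ⟶ b) (c : Fin d) : List (Fin b.card) :=
  (List.finRange b.card).reverse.filter fun x => ∃ h : x ∉ Set.range φ.f, φ.color ⟨x, h⟩ = c

theorem mem_colored {d : ℕ} {a b : FI d} {φ : a ⟶ b} {c : Fin d} {x : Fin b.card} :
    x ∈ colored φ c ↔ ∃ h : x ∉ Set.range φ.f, φ.color ⟨x, h⟩ = c := by
  simp [colored]

theorem nodup_colored {d : ℕ} {a b : FI d} (φ : a ⟶ b) (c : Fin d) : (colored φ c).Nodup :=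
  (List.nodup_reverse.2 (List.nodup_finRange _)).filter _

/-- The action of a morphism of `FI_2` on chains: relabel by the injection, put the labels of
colour `0` as singletons in decreasing order on the left, and the labels of colour `1` as singletons
in decreasing order on the right. -/
noncomputable def push {a b : FI 2} (φ : a ⟶ b) : Chain (Fin a.card) →ₗ[ℚ] Chain (Fin b.card) :=
  concat (singles (colored φ 0)) (singles (colored φ 1)) ∘ₗ relabel φ.f

theorem colored_perm {a b : FI 2} (φ : a ⟶ b) :
    (colored φ 0 ++ (List.finRange a.card).map φ.f ++ colored φ 1).Perm
      (List.finRange b.card) := by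
  refine (List.perm_ext_iff_of_nodup ?_ (List.nodup_finRange _)).2 fun x => ?_
  · refine List.Nodup.append (List.Nodup.append (nodup_colored _ _)
      ((List.nodup_finRange _).map φ.f.injective) ?_) (nodup_colored _ _) ?_
    · intro x hx hx'
      obtain ⟨h, -⟩ := mem_colored.1 hx
      exact h (by simpa using hx')
    · intro x hx hx'
      obtain ⟨h, h1⟩ := mem_colored.1 hx'
      rcases List.mem_append.1 hx with hx | hx
      · obtain ⟨_, h0⟩ := mem_colored.1 hx
        exact absurd (h0.symm.trans h1) (by decide)
      · exact h (by simpa using hx)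
  · simp only [List.mem_append, mem_colored, List.mem_finRange, iff_true, List.mem_map, true_and]
    by_cases h : x ∈ Set.range φ.f
    · exact Or.inl (Or.inr h)
    · have : φ.color ⟨x, h⟩ = 0 ∨ φ.color ⟨x, h⟩ = 1 := by
        generalize φ.color ⟨x, h⟩ = c
        revert c; decide
      rcases this with h' | h'
      · exact Or.inl (Or.inl ⟨h, h'⟩)
      · exact Or.inr ⟨h, h'⟩

theorem isCell_push {a b : FI 2} (φ : a ⟶ b) {w m : ℕ} (hw : 1 ≤ w)
    {s : List (List (Fin a.card))} (hs : IsCell a.card w m s) :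
    IsCell b.card w m
      (singles (colored φ 0) ++ s.map (List.map φ.f) ++ singles (colored φ 1)) := by
  obtain ⟨h1, h2, h3, h4⟩ := hs
  refine ⟨?_, fun c hc => ?_, fun c hc => ?_, ?_⟩
  · refine List.Perm.trans ?_ (colored_perm φ)
    simp only [List.flatten_append, flatten_singles, ← List.map_flatten]
    exact ((h1.map _).append_left _).append_right _
  · simp only [List.mem_append, singles, List.mem_map] at hc
    rcases hc with (⟨_, _, rfl⟩ | ⟨c, hc, rfl⟩) | ⟨_, _, rfl⟩
    exacts [by simp, by simpa using h2 c hc, by simp]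
  · simp only [List.mem_append, singles, List.mem_map] at hc
    rcases hc with (⟨_, _, rfl⟩ | ⟨c, hc, rfl⟩) | ⟨_, _, rfl⟩
    exacts [by simpa using hw, by simpa using h3 c hc, by simpa using hw]
  · have := (colored_perm φ).length_eq
    simp only [List.length_append, List.length_map, List.length_finRange, length_singles] at this ⊢
    omega

theorem push_mem_chains {a b : FI 2} (φ : a ⟶ b) {w m : ℕ} (hw : 1 ≤ w)
    {x : Chain (Fin a.card)} (hx : x ∈ chains a.card w m) : push φ x ∈ chains b.card w m := by
  classical
  refine concat_mem_chains fun u hu => ?_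
  obtain ⟨s, hs, rfl⟩ := Finset.mem_image.1 (Finsupp.mapDomain_support hu)
  exact isCell_push φ hw (hx hs)

theorem boundary_push {a b : FI 2} (φ : a ⟶ b) (x : Chain (Fin a.card)) :
    boundary (push φ x) = (-1 : ℚ) ^ (colored φ 0).length • push φ (boundary x) := by
  simp [push, boundary_concat_singles, boundary_relabel]

theorem push_mem_cycles {a b : FI 2} (φ : a ⟶ b) {w m : ℕ} (hw : 1 ≤ w) :
    ∀ x ∈ cycles a.card w m, push φ x ∈ cycles b.card w m := fun x hx =>
  ⟨push_mem_chains φ hw hx.1, by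
    have : boundary x = 0 := hx.2
    simp [boundary_push, this]⟩

theorem push_mem_boundaries {a b : FI 2} (φ : a ⟶ b) {w m : ℕ} (hw : 1 ≤ w)
    {x : Chain (Fin a.card)} (hx : x ∈ boundaries a.card w m) :
    push φ x ∈ boundaries b.card w m := by
  obtain ⟨y, hy, rfl⟩ := hx
  refine ⟨(-1 : ℚ) ^ (colored φ 0).length • push φ y,
    Submodule.smul_mem _ _ (push_mem_chains φ hw hy), ?_⟩
  simp [boundary_push, smul_smul, ← pow_add, ← two_mul]

/-- The map on homology induced by `push φ`. -/
noncomputable def homologyMap {a b : FI 2} (φ : a ⟶ b) :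
    Homology a.card 2 1 →ₗ[ℚ] Homology b.card 2 1 :=
  Submodule.mapQ _ _ ((push φ).restrict (push_mem_cycles φ one_le_two))
    fun _ hx => push_mem_boundaries φ one_le_two hx

/-- The homology class of a cycle. -/
noncomputable def toHomology {n w m : ℕ} (x : Chain (Fin n)) (hx : x ∈ cycles n w m) : Homology n w m :=
  Submodule.Quotient.mk ⟨x, hx⟩

theorem toHomology_eq_iff {n w m : ℕ} {x y : Chain (Fin n)} {hx : x ∈ cycles n w m}
    {hy : y ∈ cycles n w m} : toHomology x hx = toHomology y hy ↔ x - y ∈ boundaries n w m :=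
  Submodule.Quotient.eq _

theorem homologyMap_toHomology {a b : FI 2} (φ : a ⟶ b) {x : Chain (Fin a.card)}
    (hx : x ∈ cycles a.card 2 1) : homologyMap φ (toHomology x hx) =
      toHomology (push φ x) (push_mem_cycles φ one_le_two x hx) := rfl

theorem exists_toHomology {n w m : ℕ} (z : Homology n w m) :
    ∃ (x : Chain (Fin n)) (hx : x ∈ cycles n w m), toHomology x hx = z := by
  obtain ⟨⟨x, hx⟩, rfl⟩ := Submodule.Quotient.mk_surjective _ z
  exact ⟨x, hx, rfl⟩

theorem relabel_id (x : Chain α) : relabel _root_.id x = x := by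
  induction x using Finsupp.induction_linear with
  | zero => simp
  | add x y hx hy => simp [hx, hy]
  | single u a => simp

theorem relabel_relabel {γ : Type} (f : α → β) (g : β → γ) (x : Chain α) :
    relabel g (relabel f x) = relabel (g ∘ f) x := by
  induction x using Finsupp.induction_linear with
  | zero => simp
  | add x y hx hy => simp [hx, hy]
  | single u a => simp

theorem push_id (a : FI 2) (x : Chain (Fin a.card)) : push (𝟙 a) x = x := by
  have h : ∀ c, colored (𝟙 a) c = [] := fun c => List.eq_nil_iff_forall_not_mem.2 fun x hx =>
    (mem_colored.1 hx).1 ⟨x, rfl⟩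
  rw [push, h, h, LinearMap.comp_apply]
  exact (concat_nil _).trans (relabel_id x)

theorem colored_comp {d : ℕ} {a b c : FI d} (φ : a ⟶ b) (ψ : b ⟶ c) (i : Fin d) :
    (colored ψ i ++ (colored φ i).map ψ.f).Perm (colored (φ ≫ ψ) i) := by
  refine (List.perm_ext_iff_of_nodup ?_ (nodup_colored _ _)).2 fun x => ?_
  · refine List.Nodup.append (nodup_colored _ _) ((nodup_colored _ _).map ψ.f.injective) ?_
    intro x hx hx'
    obtain ⟨y, -, rfl⟩ := List.mem_map.1 hx'
    exact (mem_colored.1 hx).1 ⟨y, rfl⟩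
  · rw [List.mem_append, mem_colored, List.mem_map, mem_colored]
    constructor
    · rintro (⟨h, hc⟩ | ⟨y, hy, rfl⟩)
      · have h' : x ∉ Set.range (φ ≫ ψ).f := fun ⟨t, ht⟩ => h ⟨_, ht⟩
        exact ⟨h', (FI.Hom.comp_color_of_notMem φ ψ x h' h).trans hc⟩
      · obtain ⟨h, hc⟩ := mem_colored.1 hy
        have h' : ψ.f y ∉ Set.range (φ ≫ ψ).f := fun ⟨t, ht⟩ => h ⟨t, ψ.f.injective ht⟩
        exact ⟨h', (FI.Hom.comp_color_apply φ ψ y h' h).trans hc⟩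
    · rintro ⟨h, hc⟩
      by_cases hx : x ∈ Set.range ψ.f
      · obtain ⟨y, rfl⟩ := hx
        have h' : y ∉ Set.range φ.f := fun ⟨t, ht⟩ => h ⟨t, by rw [← ht]; rfl⟩
        exact Or.inr ⟨y, mem_colored.2 ⟨h', (FI.Hom.comp_color_apply φ ψ y h h').symm.trans hc⟩,
          rfl⟩
      · exact Or.inl ⟨hx, (FI.Hom.comp_color_of_notMem φ ψ x h hx).symm.trans hc⟩

theorem push_comp {a b c : FI 2} (φ : a ⟶ b) (ψ : b ⟶ c) (x : Chain (Fin a.card))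
    (hx : x ∈ cycles a.card 2 1) :
    push (φ ≫ ψ) x - push ψ (push φ x) ∈ boundaries c.card 2 1 := by
  classical
  have h0 : boundary x = 0 := hx.2
  have e : push ψ (push φ x) =
      concat (singles (colored ψ 0 ++ (colored φ 0).map ψ.f))
        (singles ((colored φ 1).map ψ.f ++ colored ψ 1)) (relabel (φ ≫ ψ).f x) := by
    simp only [push, LinearMap.comp_apply, relabel_concat, concat_concat, relabel_relabel,
      map_singles, singles_append]
    rfl
  rw [e, push, LinearMap.comp_apply]
  refine concat_perm le_rfl (colored_comp φ ψ 0).symm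
    ((colored_comp φ ψ 1).symm.trans List.perm_append_comm) ?_ fun u hu => ?_
  · rw [boundary_relabel, h0, map_zero]
  · obtain ⟨s, hs, rfl⟩ := Finset.mem_image.1 (Finsupp.mapDomain_support hu)
    exact isCell_push _ one_le_two (hx.1 hs)

/-- The `FI_2`-module `H_1(cell(•, 2); ℚ)`. Permutations act by relabelling, and the standard
inclusion `[n] ↪ [n + 1]` with `n + 1` coloured `0` resp. `1` acts as the high-insertion map
`[ι_0]` resp. `[ι_1]`, which puts the new label as a singleton on the left resp. on the right of the
barrier. -/
noncomputable def H1 : FIMod 2 where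
  obj a := ModuleCat.of ℚ (Homology a.card 2 1)
  map φ := ModuleCat.ofHom (homologyMap φ)
  map_id a := by
    refine ModuleCat.hom_ext (LinearMap.ext fun z => ?_)
    obtain ⟨x, hx, rfl⟩ := exists_toHomology z
    exact (homologyMap_toHomology _ hx).trans (by congr 1; exact push_id a x)
  map_comp φ ψ := by
    refine ModuleCat.hom_ext (LinearMap.ext fun z => ?_)
    obtain ⟨x, hx, rfl⟩ := exists_toHomology z
    exact toHomology_eq_iff.2 (push_comp φ ψ x hx)

/-- The high-insertion map `[ι_j] : H_1(cell(n, 2); ℚ) → H_1(cell(n + 1, 2); ℚ)`. -/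
noncomputable def highInsertion (n : ℕ) (j : Fin 2) : Homology n 2 1 →ₗ[ℚ] Homology (n + 1) 2 1 :=
  (H1.map (FI.insertion n j)).hom

theorem colored_insertion (n : ℕ) (i j : Fin 2) :
    colored (FI.insertion n j) i = if i = j then [Fin.last n] else [] := by
  have h : ∀ x, x ∈ colored (FI.insertion n j) i ↔ x = Fin.last n ∧ i = j := by
    intro x
    rw [mem_colored]
    constructor
    · rintro ⟨h, hc⟩
      refine ⟨?_, hc.symm⟩
      by_contra hx
      exact h ⟨Fin.castPred x hx, Fin.castSucc_castPred x hx⟩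
    · rintro ⟨rfl, rfl⟩
      exact ⟨fun ⟨y, hy⟩ => (Fin.castSucc_lt_last y).ne hy, rfl⟩
  split_ifs with hij
  · refine List.perm_singleton.1 ((List.perm_ext_iff_of_nodup (nodup_colored _ _)
      (List.nodup_singleton _)).2 fun x => ?_)
    exact (h x).trans (by simp [hij])
  · exact List.eq_nil_iff_forall_not_mem.2 fun x hx => hij ((h x).1 hx).2

/-- `[ι_0]` puts the new label in front: `[ι_0][x] = [n+1|x]`. -/
theorem highInsertion_zero (n : ℕ) {x : Chain (Fin n)} (hx : x ∈ cycles n 2 1) :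
    ∃ h, highInsertion n 0 (toHomology x hx) =
      toHomology (concat [[Fin.last n]] [] (relabel Fin.castSucc x)) h := by
  have e : push (FI.insertion n 0) x = concat [[Fin.last n]] [] (relabel Fin.castSucc x) := by
    rw [push, colored_insertion, colored_insertion]
    rfl
  refine ⟨e ▸ push_mem_cycles (FI.insertion n 0) one_le_two x hx, ?_⟩
  refine (homologyMap_toHomology (FI.insertion n 0) hx).trans ?_
  congr 1

/-- `[ι_1]` puts the new label right after the barrier: `[ι_1][p₁|⋯|p_r|x|q₁|⋯|q_s]` is the class of
`p₁|⋯|p_r|x|n+1|q₁|⋯|q_s` for every cycle `x`. -/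
theorem highInsertion_one (n : ℕ) (p q : List (Fin n)) {x : Chain (Fin n)} (h0 : boundary x = 0)
    (hx : concat (singles p) (singles q) x ∈ cycles n 2 1) :
    ∃ h, highInsertion n 1 (toHomology _ hx) =
      toHomology (concat (singles (p.map Fin.castSucc))
        (singles (Fin.last n :: q.map Fin.castSucc)) (relabel Fin.castSucc x)) h := by
  classical
  have e : push (FI.insertion n 1) (concat (singles p) (singles q) x) =
      concat (singles (p.map Fin.castSucc)) (singles (q.map Fin.castSucc ++ [Fin.last n]))
        (relabel Fin.castSucc x) := by
    rw [push, colored_insertion, colored_insertion, LinearMap.comp_apply, relabel_concat,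
      concat_concat, map_singles, map_singles, singles_append]
    rfl
  have hb : boundary (relabel (Fin.castSucc : Fin n → _) x) = 0 := by
    rw [boundary_relabel, h0, map_zero]
  have hinj : Function.Injective fun u : List (List (Fin n)) => singles p ++ u ++ singles q :=
    fun u v huv => by simpa using huv
  have hc : ∀ u ∈ (relabel (Fin.castSucc : Fin n → _) x).support,
      IsCell (n + 1) 2 1 (singles (p.map Fin.castSucc) ++ u ++
        singles (q.map Fin.castSucc ++ [Fin.last n])) := by
    intro u hu
    obtain ⟨s, hs, rfl⟩ := Finset.mem_image.1 (Finsupp.mapDomain_support hu)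
    have hs' : singles p ++ s ++ singles q ∈ (concat (singles p) (singles q) x).support := by
      rw [concat, Finsupp.lmapDomain_apply, Finsupp.mapDomain_support_of_injective hinj]
      exact Finset.mem_image_of_mem _ hs
    have := isCell_push (FI.insertion n 1) one_le_two (hx.1 hs')
    rw [colored_insertion, colored_insertion] at this
    simp only [List.map_append, map_singles, singles_append, ← List.append_assoc] at this ⊢
    exact this
  have hp : (q.map Fin.castSucc ++ [Fin.last n]).Perm (Fin.last n :: q.map Fin.castSucc) :=
    List.perm_append_comm
  refine ⟨⟨concat_mem_chains fun u hu => (hc u hu).of_perm ((singles_perm hp).append_left _), ?_⟩, ?_⟩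
  · show boundary _ = 0
    rw [boundary_concat_singles, hb]
    simp
  · refine (homologyMap_toHomology (FI.insertion n 1) hx).trans (toHomology_eq_iff.2 ?_)
    have := concat_perm le_rfl (List.Perm.refl (p.map Fin.castSucc)) hp hb hc
    rw [← e] at this
    exact this

/-! ### The classes in `B_n` -/

/-- The critical cells `i_1|⋯|i_m|i_{m+1} i_{m+2}|i_{m+3}|⋯|i_n` on `[n]`, `0 ≤ m ≤ n - 2`, with
`i_1 > ⋯ > i_m`, `i_{m+1} < i_{m+2}` and `i_{m+3} > ⋯ > i_n`, which index `B_n`. -/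
structure BCell (n : ℕ) where
  /-- the labels `i_1, …, i_m` -/
  left : List (Fin n)
  /-- the label `i_{m+1}` -/
  fst : Fin n
  /-- the label `i_{m+2}` -/
  snd : Fin n
  /-- the labels `i_{m+3}, …, i_n` -/
  right : List (Fin n)
  perm : (left ++ fst :: snd :: right).Perm (List.finRange n)
  left_decreasing : left.Pairwise (· > ·)
  fst_lt_snd : fst < snd
  right_decreasing : right.Pairwise (· > ·)

/-- The cycle `z(a b) = a b + b a`. -/
noncomputable def zPair (a b : α) : Chain α :=
  Finsupp.single [[a, b]] 1 + Finsupp.single [[b, a]] 1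

theorem boundary_zPair (a b : α) : boundary (zPair a b) = 0 := by
  simp [zPair, symbolBoundary]

theorem concat_zPair_mem_cycles {n : ℕ} (p q : List (Fin n)) (a b : Fin n)
    (h : (p ++ a :: b :: q).Perm (List.finRange n)) :
    concat (singles p) (singles q) (zPair a b) ∈ cycles n 2 1 := by
  have hc : ∀ a b : Fin n, (p ++ a :: b :: q).Perm (List.finRange n) →
      IsCell n 2 1 (singles p ++ [[a, b]] ++ singles q) := by
    intro a b h
    refine ⟨by simpa using h, fun c hc => ?_, fun c hc => ?_, ?_⟩
    · simp only [List.mem_append, singles, List.mem_map, List.mem_singleton] at hc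
      rcases hc with (⟨_, _, rfl⟩ | rfl) | ⟨_, _, rfl⟩ <;> simp
    · simp only [List.mem_append, singles, List.mem_map, List.mem_singleton] at hc
      rcases hc with (⟨_, _, rfl⟩ | rfl) | ⟨_, _, rfl⟩ <;> simp
    · have := h.length_eq
      simp only [List.length_append, List.length_cons, List.length_finRange, length_singles,
        List.length_nil] at this ⊢
      omega
  refine ⟨?_, ?_⟩
  · rw [zPair, map_add, concat_single, concat_single]
    exact Submodule.add_mem _ (Finsupp.single_mem_supported ℚ 1 (hc a b h))
      (Finsupp.single_mem_supported ℚ 1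
        (hc b a (((List.Perm.swap a b q).append_left p).trans h)))
  · show boundary _ = 0
    rw [boundary_concat_singles, boundary_zPair]
    simp

/-- The class of `z(e) = z(i_1)|⋯|z(i_m)|z(i_{m+1} i_{m+2})|z(i_{m+3})|⋯|z(i_n)`, where
`z(i) = i`. -/
noncomputable def BCell.z {n : ℕ} (e : BCell n) : Homology n 2 1 :=
  toHomology (concat (singles e.left) (singles e.right) (zPair e.fst e.snd))
    (concat_zPair_mem_cycles _ _ _ _ e.perm)

/-- The class of the cycle `z(1 2) = 1 2 + 2 1` in `H_1(cell(2, 2); ℚ)`. -/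
noncomputable def z12 : Homology 2 2 1 :=
  toHomology (concat (singles []) (singles []) (zPair 0 1))
    (concat_zPair_mem_cycles [] [] 0 1 (by simp [List.finRange_succ]))

/-- The `FI_2`-submodule of `H_1(cell(•, 2); ℚ)` generated by `z(1 2)`. -/
noncomputable def submoduleZ12 : FISubmodule H1 :=
  FISubmodule.generatedBy H1 2 z12

end Strip

/-! A morphism `[2] ⟶ [n]` of `FI_2`, taken up to precomposition with `S_2`, is an unordered pair of
labels together with a 2-colouring of the remaining ones. Sorting the pair increasingly and each
colour class decreasingly turns these orbits into exactly the critical cells that index `B_n`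
(`BCell.ofHom`, `BCell.hom`, `BCell.ofHom_hom`, `exists_perm_comp_hom`). The action is defined so
that a morphism sends `z(1 2)` to the class of its critical cell (`map_z12`); the order inside the
pair is irrelevant because `a b + b a` is symmetric. Hence `W_n` is the span of `B_n`
(`obj_submoduleZ12`), and `φ ⊗ u ↦ u φ(z(1 2))` maps `M(Triv_2)` onto `W`, matching orbits of
morphisms with elements of `B_n`.

What remains is the linear independence of `B_n` in homology, which is shown with explicit cocycles.
For a critical cell with left part `p`, pair `a b` and right part `q`, let the cochain count the
strings `p'|a b|q'` with `p'`, `q'` arbitrary rearrangements of `p`, `q`. A 2-cell has exactly two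
blocks of size two, and its boundary splits one of them, `x y`, into `x|y - y|x`. These two
singletons lie on the same side of the surviving pair, so the cochain does not see their order and
the terms cancel (`cochain_symbolBoundary`). The cochains therefore descend to homology, where they
form a family dual to `B_n` (`cocycle_z`).

With `B_n` a basis, the map from `M(Triv_2)` has an inverse defined on basis elements, and
naturality is the functoriality of `H1` applied to `z(1 2)`. -/

namespace Strip

variable {α : Type}

/-! ### The shape of the cells of dimension two -/

/-- A string of blocks of size one or two is a string of singletons, or has a first block of size
two. -/
theorem eq_singles_or_exists_pair (s : List (List α)) (h0 : ∀ b ∈ s, b ≠ [])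
    (h2 : ∀ b ∈ s, b.length ≤ 2) :
    (∃ p, s = singles p) ∨ ∃ p a b t, s = singles p ++ [a, b] :: t := by
  induction s with
  | nil => exact Or.inl ⟨[], rfl⟩
  | cons c s ih =>
    have hc0 := h0 c (by simp)
    have hc2 := h2 c (by simp)
    match c, hc0, hc2 with
    | [a], _, _ =>
      rcases ih (fun b hb => h0 b (by simp [hb])) (fun b hb => h2 b (by simp [hb])) with
        ⟨p, rfl⟩ | ⟨p, x, y, t, rfl⟩
      · exact Or.inl ⟨a :: p, rfl⟩
      · exact Or.inr ⟨a :: p, x, y, t, rfl⟩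
    | [a, b], _, _ => exact Or.inr ⟨[], a, b, s, rfl⟩

/-- The number of labels minus the number of blocks is the number of blocks of size two, so a 2-cell
has exactly two of them. Pairs are peeled off from the left, and every other count contradicts
`dim`. -/
theorem IsCell.exists_eq_of_dim_two {n : ℕ} {s : List (List (Fin n))} (hs : IsCell n 2 2 s) :
    ∃ p a b t c d q, s = singles p ++ [a, b] :: (singles t ++ [c, d] :: singles q) := by
  obtain ⟨hp, h0, h2, hd⟩ := hs
  have hl := hp.length_eq
  rw [List.length_finRange] at hl
  rcases eq_singles_or_exists_pair s h0 h2 with ⟨p, rfl⟩ | ⟨p, a, b, s, rfl⟩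
  · rw [flatten_singles] at hl
    rw [length_singles] at hd
    omega
  rcases eq_singles_or_exists_pair s (fun b hb => h0 b (by simp [hb]))
    (fun b hb => h2 b (by simp [hb])) with ⟨t, rfl⟩ | ⟨t, c, d, s, rfl⟩
  · simp at hl hd
    omega
  rcases eq_singles_or_exists_pair s (fun b hb => h0 b (by simp [hb]))
    (fun b hb => h2 b (by simp [hb])) with ⟨q, rfl⟩ | ⟨q, x, y, u, rfl⟩
  · exact ⟨p, a, b, t, c, d, q, rfl⟩
  -- A third pair already accounts for an excess of three labels over blocks. The unknown tail `u`
  -- cannot compensate, since its blocks are nonempty.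
  · have : u.length ≤ u.flatten.length := by
      rw [List.length_flatten]
      have := List.card_nsmul_le_sum (u.map List.length) 1 (by
        intro k hk
        obtain ⟨b, hb, rfl⟩ := List.mem_map.1 hk
        exact List.length_pos_of_ne_nil (h0 b (by simp [hb])))
      simpa using this
    simp at hl hd this
    omega

/-- The only block of size two marks its own position, so the string can be cut there in one way
only. -/
theorem singles_append_pair_inj {p p' q q' : List α} {a b a' b' : α}
    (h : singles p ++ [a, b] :: singles q = singles p' ++ [a', b'] :: singles q') :
    p = p' ∧ a = a' ∧ b = b' ∧ q = q' := by
  induction p generalizing p' with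
  | nil =>
    cases p' with
    | nil =>
      simp only [singles_nil, List.nil_append, List.cons.injEq, and_true] at h
      exact ⟨rfl, h.1.1, h.1.2, List.map_injective_iff.2 (fun x y hxy => by simpa using hxy) h.2⟩
    | cons x p' => simp at h
  | cons x p ih =>
    cases p' with
    | nil => simp at h
    | cons y p' =>
      simp only [singles_cons, List.cons_append, List.cons.injEq, and_true] at h
      obtain ⟨rfl, h⟩ := h
      obtain ⟨rfl, h'⟩ := ih h
      exact ⟨rfl, h'⟩

/-! ### Cocycles that separate the classes in `B_n` -/

open scoped Classical in
/-- The cochain that counts the strings `p|a b|q` in which `p` and `q` are given up to order. -/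
noncomputable def cochain (p : List α) (a b : α) (q : List α) : Chain α →ₗ[ℚ] ℚ :=
  Finsupp.lsum ℚ fun s =>
    if ∃ p' q', p'.Perm p ∧ q'.Perm q ∧ s = singles p' ++ [a, b] :: singles q'
    then LinearMap.id else 0

theorem cochain_single (p p' q q' : List α) (a b a' b' : α) (c : ℚ)
    [Decidable (p'.Perm p ∧ q'.Perm q ∧ a' = a ∧ b' = b)] :
    cochain p a b q (Finsupp.single (singles p' ++ [a', b'] :: singles q') c) =
      if p'.Perm p ∧ q'.Perm q ∧ a' = a ∧ b' = b then c else 0 := by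
  have : (∃ p'' q'', p''.Perm p ∧ q''.Perm q ∧
      singles p' ++ [a', b'] :: singles q' = singles p'' ++ [a, b] :: singles q'') ↔
      (p'.Perm p ∧ q'.Perm q ∧ a' = a ∧ b' = b) := by
    constructor
    · rintro ⟨p'', q'', hp, hq, h⟩
      obtain ⟨rfl, rfl, rfl, rfl⟩ := singles_append_pair_inj h
      exact ⟨hp, hq, rfl, rfl⟩
    · rintro ⟨hp, hq, rfl, rfl⟩
      exact ⟨p', q', hp, hq, rfl⟩
  simp only [cochain, Finsupp.lsum_single, this]
  split_ifs <;> rfl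

theorem cochain_single_congr (p q : List α) (a b : α) {p₁ p₂ q₁ q₂ : List α} (x y : α) (c : ℚ)
    (hp : p₁.Perm p₂) (hq : q₁.Perm q₂) :
    cochain p a b q (Finsupp.single (singles p₁ ++ [x, y] :: singles q₁) c) =
      cochain p a b q (Finsupp.single (singles p₂ ++ [x, y] :: singles q₂) c) := by
  classical
  rw [cochain_single, cochain_single]
  congr 1
  rw [hp.congr_left, hq.congr_left]

/-- Splitting `x y` gives two strings of opposite sign that differ by a swap to the left of `z w`;
splitting `z w` gives two that differ by a swap to the right of `x y`. Since the cochain ignores the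
order of the singletons on either side, each pair of terms cancels, whatever the global sign. -/
theorem cochain_symbolBoundary (p q : List α) (a b : α) (p' t q' : List α) (x y z w : α) :
    cochain p a b q (symbolBoundary
      (singles p' ++ [x, y] :: (singles t ++ [z, w] :: singles q'))) = 0 := by
  have h1 := cochain_single_congr p q a b (p₁ := p' ++ x :: y :: t) (p₂ := p' ++ y :: x :: t) z w 1
    ((List.Perm.swap y x t).append_left p') (List.Perm.refl q')
  have h2 := cochain_single_congr p q a b (q₁ := t ++ z :: w :: q') (q₂ := t ++ w :: z :: q') x y 1
    (List.Perm.refl p') ((List.Perm.swap w z q').append_left t)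
  simp only [singles_append, singles_cons, List.append_assoc, List.cons_append] at h1 h2
  rw [symbolBoundary_append, symbolBoundary, symbolBoundary_append, symbolBoundary,
    symbolBoundary_singles, symbolBoundary_singles, symbolBoundary_singles]
  -- The scalars stay outside `Finsupp.single`, so that `h1` and `h2`, stated with coefficient `1`,
  -- still match.
  simp [smul_sub, h1, h2, -Finsupp.smul_single]

theorem cochain_boundary {n : ℕ} (p q : List (Fin n)) (a b : Fin n) {x : Chain (Fin n)}
    (hx : x ∈ boundaries n 2 1) : cochain p a b q x = 0 := by
  obtain ⟨y, hy, rfl⟩ := hx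
  rw [boundary, Finsupp.lsum_apply, Finsupp.sum, map_sum]
  refine Finset.sum_eq_zero fun s hs => ?_
  obtain ⟨p', x, y, t, z, w, q', rfl⟩ := IsCell.exists_eq_of_dim_two (hy hs)
  rw [LinearMap.toSpanSingleton_apply, map_smul, cochain_symbolBoundary, smul_zero]

/-- The linear form on `H_1(cell(n, 2); ℚ)` induced by `cochain`. -/
noncomputable def cocycle {n : ℕ} (e : BCell n) : Homology n 2 1 →ₗ[ℚ] ℚ :=
  Submodule.liftQ _ (cochain e.left e.fst e.snd e.right ∘ₗ (cycles n 2 1).subtype)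
    fun _ hx => cochain_boundary _ _ _ _ hx

/-- A decreasing list is determined by its entries. This is why a cochain blind to the order of
singletons still separates critical cells. -/
theorem BCell.ext_of {n : ℕ} {e e' : BCell n} (hl : e.left.Perm e'.left) (hf : e.fst = e'.fst)
    (hs : e.snd = e'.snd) (hr : e.right.Perm e'.right) : e = e' := by
  have hl' := hl.eq_of_pairwise' e.left_decreasing e'.left_decreasing
  have hr' := hr.eq_of_pairwise' e.right_decreasing e'.right_decreasing
  cases e
  cases e'
  subst hl' hr' hf hs
  rfl

open scoped Classical in
-- Of the two strings in the cycle of `e'`, the one with the pair in decreasing order is never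
-- counted, because `e.fst < e.snd`. The other one is counted exactly when the data agree up to the
-- order of the singletons.
theorem cocycle_z {n : ℕ} (e e' : BCell n) : cocycle e e'.z = if e' = e then 1 else 0 := by
  have h : cocycle e e'.z = cochain e.left e.fst e.snd e.right
      (concat (singles e'.left) (singles e'.right) (zPair e'.fst e'.snd)) := rfl
  rw [h, zPair, map_add, concat_single, concat_single, map_add, List.append_assoc,
    List.append_assoc, List.singleton_append, List.singleton_append, cochain_single,
    cochain_single, add_eq_left.2 (if_neg _)]
  · refine if_congr ⟨fun ⟨h1, h2, h3, h4⟩ => BCell.ext_of h1 h3 h4 h2, ?_⟩ rfl rfl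
    rintro rfl
    exact ⟨.refl _, .refl _, rfl, rfl⟩
  · rintro ⟨-, -, h1, h2⟩
    have := e.fst_lt_snd
    rw [← h1, ← h2] at this
    exact this.asymm e'.fst_lt_snd

/-- By duality, `cocycle e` reads off the coefficient at `e` of any linear relation. -/
theorem linearIndependent_z (n : ℕ) : LinearIndependent ℚ (BCell.z : BCell n → Homology n 2 1) := by
  classical
  rw [linearIndependent_iff]
  intro l hl
  ext e
  have := congrArg (cocycle e) hl
  rw [Finsupp.linearCombination_apply, Finsupp.sum, map_sum, map_zero] at this
  simpa [cocycle_z] using this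

/-! ### Morphisms out of `[2]` -/

theorem colored_decreasing {d : ℕ} {a b : FI d} (φ : a ⟶ b) (c : Fin d) :
    (colored φ c).Pairwise (· > ·) :=
  (List.pairwise_reverse.2 (List.pairwise_lt_finRange _)).filter _

theorem apply_zero_ne_apply_one {n : ℕ} (φ : (FI.of 2 : FI 2) ⟶ FI.of n) :
    φ.f (0 : Fin 2) ≠ φ.f (1 : Fin 2) :=
  fun h => absurd (φ.f.injective h) (by decide)

/-- The critical cell that is obtained from `1 2` by a morphism `[2] ⟶ [n]`. -/
noncomputable def BCell.ofHom {n : ℕ} (φ : (FI.of 2 : FI 2) ⟶ FI.of n) : BCell n where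
  left := colored φ 0
  fst := min (φ.f (0 : Fin 2)) (φ.f (1 : Fin 2))
  snd := max (φ.f (0 : Fin 2)) (φ.f (1 : Fin 2))
  right := colored φ 1
  perm := by
    have h : (List.finRange 2).map φ.f = [φ.f (0 : Fin 2), φ.f (1 : Fin 2)] := by
      simp [List.finRange_succ]
    have := colored_perm φ
    -- `Fin (FI.of 2).card` is `Fin 2` only after unfolding, which `rw` does not see.
    erw [h, List.append_assoc] at this
    refine List.Perm.trans (List.Perm.append_left _ ?_) this
    rcases le_total (φ.f (0 : Fin 2)) (φ.f (1 : Fin 2)) with h | h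
    · rw [min_eq_left h, max_eq_right h]
      exact .refl _
    · rw [min_eq_right h, max_eq_left h]
      exact .swap _ _ _
  left_decreasing := colored_decreasing φ 0
  fst_lt_snd := min_lt_max.2 (apply_zero_ne_apply_one φ)
  right_decreasing := colored_decreasing φ 1

theorem zPair_comm {α : Type} (a b : α) : zPair a b = zPair b a := add_comm _ _

/-- The equality holds already for the representing cycles: `push` places the coloured labels in the
decreasing order that a critical cell requires, and sorting the pair is harmless by `zPair_comm`. -/
theorem map_z12 {n : ℕ} (φ : (FI.of 2 : FI 2) ⟶ FI.of n) : H1.map φ z12 = (BCell.ofHom φ).z := by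
  refine (homologyMap_toHomology φ (concat_zPair_mem_cycles [] [] 0 1
    (by simp [List.finRange_succ]))).trans ?_
  have h : relabel φ.f (zPair (0 : Fin 2) 1) =
      zPair (BCell.ofHom φ).fst (BCell.ofHom φ).snd := by
    have h' : relabel φ.f (zPair (0 : Fin 2) 1) = zPair (φ.f (0 : Fin 2)) (φ.f (1 : Fin 2)) := by
      simp [zPair]
    rw [h']
    show _ = zPair (min (φ.f (0 : Fin 2)) (φ.f (1 : Fin 2))) (max (φ.f (0 : Fin 2)) (φ.f (1 : Fin 2)))
    rcases le_total (φ.f (0 : Fin 2)) (φ.f (1 : Fin 2)) with h | h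
    · rw [min_eq_left h, max_eq_right h]
    · rw [min_eq_right h, max_eq_left h, zPair_comm]
  unfold BCell.z
  congr 1
  rw [← h]
  simp only [singles_nil, concat_nil]
  rfl

/-! ### Critical cells as morphisms out of `[2]` -/

namespace BCell

variable {n : ℕ} (e : BCell n)

theorem nodup : (e.left ++ e.fst :: e.snd :: e.right).Nodup :=
  e.perm.nodup_iff.2 (List.nodup_finRange n)

theorem mem (x : Fin n) : x ∈ e.left ∨ x = e.fst ∨ x = e.snd ∨ x ∈ e.right := by
  simpa using e.perm.mem_iff.2 (List.mem_finRange x)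

/-- The morphism `[2] ⟶ [n]` that takes `1 2` to a given critical cell. -/
def hom : (FI.of 2 : FI 2) ⟶ FI.of n where
  f := ⟨fun i : Fin 2 => if i = 0 then e.fst else e.snd, by
    have := e.fst_lt_snd.ne
    intro i j
    fin_cases i <;> fin_cases j <;> simp [this, this.symm]⟩
  -- A label outside the image lies in `left` or in `right`, so the default colour `1` is taken
  -- exactly on `right`.
  color x := if x.1 ∈ e.left then 0 else 1

theorem range_hom : Set.range e.hom.f = {e.fst, e.snd} := by
  ext x
  constructor
  · rintro ⟨i, rfl⟩
    revert i
    exact Fin.forall_fin_two.2 ⟨Or.inl rfl, Or.inr rfl⟩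
  · rintro (rfl | rfl)
    exacts [⟨(0 : Fin 2), rfl⟩, ⟨(1 : Fin 2), rfl⟩]

theorem notMem_range_hom {x : Fin n} (hx : x ∈ e.left ∨ x ∈ e.right) :
    x ∉ Set.range e.hom.f := by
  have hn := e.nodup
  rw [range_hom]
  simp only [List.nodup_append, List.nodup_cons, List.mem_cons] at hn
  rintro (rfl | rfl) <;> grind

theorem hom_color (x : Fin n) (h : x ∉ Set.range e.hom.f) :
    e.hom.color ⟨x, h⟩ = if x ∈ e.left then 0 else 1 := rfl

theorem mem_colored_hom_zero (x : Fin n) : x ∈ colored e.hom 0 ↔ x ∈ e.left := by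
  rw [mem_colored]
  constructor
  · rintro ⟨h, hc⟩
    rw [hom_color] at hc
    by_contra hx
    simp [hx] at hc
  · intro hx
    refine ⟨e.notMem_range_hom (.inl hx), ?_⟩
    rw [hom_color, if_pos hx]

theorem mem_colored_hom_one (x : Fin n) : x ∈ colored e.hom 1 ↔ x ∈ e.right := by
  rw [mem_colored]
  constructor
  · rintro ⟨h, hc⟩
    rw [hom_color] at hc
    rw [range_hom] at h
    have := e.mem x
    by_cases hx : x ∈ e.left
    · simp [hx] at hc
    · simp_all
  · intro hx
    refine ⟨e.notMem_range_hom (.inr hx), ?_⟩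
    rw [hom_color, if_neg]
    intro hx'
    exact (List.nodup_append.1 e.nodup).2.2 x hx' x (by simp [hx]) rfl

/-- Every critical cell thus comes from a morphism, which puts all of `B_n` into `W`. -/
theorem ofHom_hom : ofHom e.hom = e := by
  have hn := e.nodup
  refine ext_of ?_ (min_eq_left e.fst_lt_snd.le) (max_eq_right e.fst_lt_snd.le) ?_
  · exact (List.perm_ext_iff_of_nodup (nodup_colored _ _) hn.of_append_left).2
      e.mem_colored_hom_zero
  · exact (List.perm_ext_iff_of_nodup (nodup_colored _ _)
      hn.of_append_right.of_cons.of_cons).2 e.mem_colored_hom_one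

theorem map_hom_z12 : H1.map e.hom z12 = e.z := by
  rw [map_z12, ofHom_hom]

end BCell

/-! ### Orbits of morphisms under permutations of the source -/

theorem color_eq_of_colored {d : ℕ} {a b : FI d} {φ ψ : a ⟶ b}
    (hc : ∀ c, colored φ c = colored ψ c) (x : Fin b.card) (h₁ : x ∉ Set.range φ.f)
    (h₂ : x ∉ Set.range ψ.f) : φ.color ⟨x, h₁⟩ = ψ.color ⟨x, h₂⟩ := by
  have h : x ∈ colored ψ (φ.color ⟨x, h₁⟩) := by
    rw [← hc]
    exact mem_colored.2 ⟨h₁, rfl⟩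
  obtain ⟨_, h⟩ := mem_colored.1 h
  exact h.symm

/-- A permutation of the source leaves the image, and with it the coloured complement, unchanged. -/
theorem colored_perm_comp {d m : ℕ} {b : FI d} (σ : Equiv.Perm (Fin m))
    (φ : (FI.of m : FI d) ⟶ b) (c : Fin d) : colored (FI.perm d σ ≫ φ) c = colored φ c := by
  have h : colored (FI.perm d σ) c = [] := List.eq_nil_iff_forall_not_mem.2 fun x hx =>
    (mem_colored.1 hx).1 (σ.surjective x)
  have := colored_comp (FI.perm d σ) φ c
  rw [h, List.map_nil, List.append_nil] at this
  exact (this.eq_of_pairwise' (colored_decreasing φ c) (colored_decreasing _ c)).symm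

/-- Morphisms out of `[2]` with the same critical cell differ by a permutation of `[2]`. -/
theorem exists_perm_comp_hom {n : ℕ} (φ : (FI.of 2 : FI 2) ⟶ FI.of n) :
    ∃ σ, φ = FI.perm 2 σ ≫ (BCell.ofHom φ).hom := by
  have hc : ∀ (σ : Equiv.Perm (Fin 2)) (c : Fin 2),
      colored φ c = colored (FI.perm 2 σ ≫ (BCell.ofHom φ).hom) c := by
    intro σ c
    have e := (BCell.ofHom φ).ofHom_hom
    rw [colored_perm_comp]
    revert c
    exact Fin.forall_fin_two.2 ⟨(congrArg BCell.left e).symm, (congrArg BCell.right e).symm⟩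
  -- The colours agree for every `σ`, so `σ` only has to undo the sorting of the pair.
  rcases le_total (φ.f (0 : Fin 2)) (φ.f (1 : Fin 2)) with h | h
  · refine ⟨1, FI.Hom.ext_of ?_ (color_eq_of_colored (hc 1))⟩
    exact Fin.forall_fin_two.2 ⟨(min_eq_left h).symm, (max_eq_right h).symm⟩
  · refine ⟨Equiv.swap 0 1, FI.Hom.ext_of ?_ (color_eq_of_colored (hc _))⟩
    exact Fin.forall_fin_two.2 ⟨(max_eq_left h).symm, (min_eq_right h).symm⟩

/-! ### The submodule generated by `z(1 2)` -/

theorem z12_mem : z12 ∈ submoduleZ12.obj 2 :=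
  (Submodule.mem_iInf (M := H1.obj (FI.of 2)) _).2 fun _ =>
    (Submodule.mem_iInf (M := H1.obj (FI.of 2)) _).2 id

/-- The span of the families `B_n`. -/
noncomputable def spanZ : FISubmodule H1 where
  obj n := Submodule.span ℚ (Set.range (BCell.z : BCell n → Homology n 2 1))
  map_mem {a b} ψ x hx := by
    have h : Submodule.span ℚ (Set.range (BCell.z : BCell a → Homology a 2 1)) ≤
        (Submodule.span ℚ (Set.range (BCell.z : BCell b → Homology b 2 1))).comap
          (H1.map ψ).hom := by
      refine Submodule.span_le.2 ?_
      rintro _ ⟨e, rfl⟩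
      -- Since `e.z` is the image of `z12` under `e.hom`, its image under `ψ` is that of `z12` under
      -- a composite, hence again a member of the family.
      refine Submodule.subset_span ⟨BCell.ofHom (e.hom ≫ ψ), ?_⟩
      rw [← map_z12, H1.map_comp, ← e.map_hom_z12]
      rfl
    exact h hx

theorem z_mem {n : ℕ} (e : BCell n) : e.z ∈ submoduleZ12.obj n :=
  e.map_hom_z12 ▸ submoduleZ12.map_mem e.hom _ z12_mem

/-- Minimality gives one inclusion: `spanZ` is a submodule that contains `z12`, as the class
attached to the identity of `[2]`. The other inclusion is `z_mem`. -/
theorem obj_submoduleZ12 (n : ℕ) : submoduleZ12.obj n =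
    Submodule.span ℚ (Set.range (BCell.z : BCell n → H1.obj (FI.of n))) := by
  refine le_antisymm ?_ (Submodule.span_le.2 ?_)
  · refine iInf₂_le spanZ ?_
    refine Submodule.subset_span ⟨BCell.ofHom (𝟙 _), ?_⟩
    rw [← map_z12, H1.map_id]
    rfl
  · rintro _ ⟨e, rfl⟩
    exact z_mem e

theorem linearIndependent_z_H1 (n : ℕ) :
    LinearIndependent ℚ (BCell.z : BCell n → H1.obj (FI.of n)) :=
  linearIndependent_z n

/-- The basis `B_n`. -/
noncomputable def basisZ (n : ℕ) : Module.Basis (BCell n) ℚ (submoduleZ12.obj n) :=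
  (Module.Basis.span (linearIndependent_z_H1 n)).map (LinearEquiv.ofEq _ _ (obj_submoduleZ12 n).symm)

theorem coe_basisZ {n : ℕ} (e : BCell n) :
    ((basisZ n e : submoduleZ12.obj n) : H1.obj (FI.of n)) = e.z :=
  congrArg Subtype.val (Module.Basis.span_apply (linearIndependent_z_H1 n) e)

theorem basisZ_ofHom {n : ℕ} (φ : (FI.of 2 : FI 2) ⟶ FI.of n) :
    basisZ n (BCell.ofHom φ) = ⟨H1.map φ z12, submoduleZ12.map_mem φ _ z12_mem⟩ :=
  Subtype.ext ((coe_basisZ _).trans (map_z12 φ).symm)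

/-! ### Freeness -/

/-- The trivial representation of `S_2`. -/
abbrev triv : Representation ℚ (Equiv.Perm (Fin 2)) ℚ := Representation.trivial ℚ _ ℚ

/-- The map `φ ⊗ u ↦ u φ(z(1 2))`. -/
noncomputable def fromFree (n : ℕ) :
    (((((FI.of 2 : FI 2) ⟶ FI.of n) →₀ ℚ) ⊗[ℚ] ℚ) ⧸ FI.balanced 2 triv (FI.of n)) →ₗ[ℚ]
      submoduleZ12.obj n :=
  Submodule.liftQ _
    (Finsupp.linearCombination ℚ (fun φ => basisZ n (BCell.ofHom φ)) ∘ₗ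
      (TensorProduct.rid ℚ (((FI.of 2 : FI 2) ⟶ FI.of n) →₀ ℚ)).toLinearMap) (by
    refine Submodule.span_le.2 ?_
    rintro _ ⟨σ, φ, u, rfl⟩
    -- The representation is trivial, so the relations only ask that the critical cell be constant
    -- on `S_2`-orbits; `min` and `max` are symmetric.
    have h : BCell.ofHom (FI.perm 2 σ ≫ φ) = BCell.ofHom φ := by
      have h2 : ∀ σ : Equiv.Perm (Fin 2),
          (σ 0 = 0 ∧ σ 1 = 1) ∨ (σ 0 = 1 ∧ σ 1 = 0) := by decide
      have e : ∀ i : Fin 2, (FI.perm 2 σ ≫ φ).f i = φ.f (σ i) := fun _ => rfl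
      refine BCell.ext_of (.of_eq (colored_perm_comp σ φ 0)) ?_ ?_
        (.of_eq (colored_perm_comp σ φ 1))
      · simp only [BCell.ofHom, e]
        rcases h2 σ with ⟨h0, h1⟩ | ⟨h0, h1⟩ <;> rw [h0, h1]
        exact min_comm _ _
      · simp only [BCell.ofHom, e]
        rcases h2 σ with ⟨h0, h1⟩ | ⟨h0, h1⟩ <;> rw [h0, h1]
        exact max_comm _ _
    simp [h])

theorem fromFree_mk {n : ℕ} (φ : (FI.of 2 : FI 2) ⟶ FI.of n) (u : ℚ) :
    fromFree n (Submodule.Quotient.mk (Finsupp.single φ 1 ⊗ₜ[ℚ] u)) =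
      u • basisZ n (BCell.ofHom φ) := by
  show Finsupp.linearCombination ℚ _ (TensorProduct.rid ℚ _ (Finsupp.single φ 1 ⊗ₜ[ℚ] u)) = _
  simp

/-- The inverse of `fromFree`. -/
noncomputable def toFree (n : ℕ) : submoduleZ12.obj n →ₗ[ℚ]
    (((((FI.of 2 : FI 2) ⟶ FI.of n) →₀ ℚ) ⊗[ℚ] ℚ) ⧸ FI.balanced 2 triv (FI.of n)) :=
  (basisZ n).constr ℚ fun e => Submodule.Quotient.mk (Finsupp.single e.hom 1 ⊗ₜ[ℚ] (1 : ℚ))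

/-- In each degree, `W` is isomorphic to `M(Triv_2)`. -/
noncomputable def freeEquiv (n : ℕ) :
    (((((FI.of 2 : FI 2) ⟶ FI.of n) →₀ ℚ) ⊗[ℚ] ℚ) ⧸ FI.balanced 2 triv (FI.of n)) ≃ₗ[ℚ]
      submoduleZ12.obj n :=
  LinearEquiv.ofLinearMap (fromFree n) (toFree n)
    ((basisZ n).ext fun e => by
      rw [LinearMap.comp_apply, toFree, Module.Basis.constr_basis, fromFree_mk, e.ofHom_hom]
      simp)
    (by
      -- Linear maps out of the quotient are compared on the generators `φ ⊗ 1`.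
      refine Submodule.linearMap_qext _ (TensorProduct.ext (Finsupp.lhom_ext' fun φ =>
        LinearMap.ext_ring (LinearMap.ext_ring ?_)))
      show toFree n (fromFree n (Submodule.Quotient.mk (Finsupp.single φ 1 ⊗ₜ[ℚ] (1 : ℚ)))) =
        Submodule.Quotient.mk (Finsupp.single φ 1 ⊗ₜ[ℚ] (1 : ℚ))
      rw [fromFree_mk, one_smul, toFree, Module.Basis.constr_basis, eq_comm,
        Submodule.Quotient.eq]
      -- The round trip replaces `φ` by the sorted representative of its orbit; the difference of
      -- the two generators is one of the defining relations.
      obtain ⟨σ, h⟩ := exists_perm_comp_hom φ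
      refine Submodule.subset_span ⟨σ, (BCell.ofHom φ).hom, 1, ?_⟩
      rw [← h]
      rfl)

/-- `W` is isomorphic to `M(Triv_2)`. -/
noncomputable def freeIso : FI.free 2 triv ≅ submoduleZ12.toFIMod :=
  NatIso.ofComponents (fun b => (freeEquiv b.card).toModuleIso) (by
    intro b c ψ
    refine ModuleCat.hom_ext (Submodule.linearMap_qext _ (TensorProduct.ext
      (Finsupp.lhom_ext' fun φ => LinearMap.ext_ring (LinearMap.ext_ring ?_))))
    have h : FI.freeMap 2 ℚ ψ (Finsupp.single φ 1 ⊗ₜ[ℚ] (1 : ℚ)) =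
        Finsupp.single (φ ≫ ψ) 1 ⊗ₜ[ℚ] (1 : ℚ) := by
      simp [FI.freeMap, Finsupp.mapDomain_single]
    show fromFree c.card (Submodule.Quotient.mk
        (FI.freeMap 2 ℚ ψ (Finsupp.single φ 1 ⊗ₜ[ℚ] (1 : ℚ)))) =
      submoduleZ12.toFIMod.map ψ
        (fromFree b.card (Submodule.Quotient.mk (Finsupp.single φ 1 ⊗ₜ[ℚ] (1 : ℚ))))
    rw [h]
    erw [fromFree_mk, fromFree_mk]
    rw [one_smul, one_smul, basisZ_ofHom, basisZ_ofHom]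
    refine Subtype.ext ?_
    -- On generators, naturality reduces to functoriality.
    show H1.map (φ ≫ ψ) z12 = H1.map ψ (H1.map φ z12)
    rw [H1.map_comp]
    rfl)

/-- The sequence of vector spaces that is `ℚ` in degree two and zero elsewhere. -/
def degreeTwo : ℕ → ModuleCat.{0} ℚ
  | 2 => ModuleCat.of ℚ ℚ
  | _ => ModuleCat.of ℚ PUnit

theorem subsingleton_degreeTwo {m : ℕ} (hm : m ≠ 2) : Subsingleton (degreeTwo m) := by
  unfold degreeTwo
  split
  · contradiction
  · exact inferInstanceAs (Subsingleton PUnit)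

theorem isZero_free {d m : ℕ} {U : Type} [AddCommGroup U] [Module ℚ U] [Subsingleton U]
    (ρ : Representation ℚ (Equiv.Perm (Fin m)) U) : IsZero (FI.free d ρ) := by
  refine Functor.isZero _ fun b => ?_
  exact @ModuleCat.isZero_of_subsingleton _ _ _
    (inferInstanceAs (Subsingleton (_ ⧸ FI.balanced d ρ b)))

/-- All summands outside degree two vanish, so the inclusion of the remaining summand into the
coproduct is an isomorphism, with the projection as inverse. -/
theorem isFree_free_triv : (FI.free 2 triv).IsFree := by
  classical
  refine ⟨degreeTwo, fun m => Representation.trivial ℚ _ (degreeTwo m), ⟨?_⟩⟩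
  let F : ℕ → FIMod 2 := fun m =>
    FI.free 2 (Representation.trivial ℚ (Equiv.Perm (Fin m)) (degreeTwo m))
  refine (⟨Sigma.ι F 2, Sigma.π F 2, ?_, ?_⟩ : F 2 ≅ ∐ F)
  · simp
  · refine Sigma.hom_ext _ _ fun m => ?_
    rcases eq_or_ne m 2 with rfl | hm
    · simp
    · have := subsingleton_degreeTwo hm
      exact (isZero_free _).eq_of_src _ _

theorem _root_.FIMod.IsFree.of_iso {d : ℕ} {V W : FIMod d} (i : V ≅ W) (h : W.IsFree) :
    V.IsFree := by
  obtain ⟨U, ρ, ⟨j⟩⟩ := h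
  exact ⟨U, ρ, ⟨i ≪≫ j⟩⟩

end Strip

theorem mainTheorem7 :
    (∀ n : ℕ, 2 ≤ n →
      ∃ b : Module.Basis (Strip.BCell n) ℚ (Strip.submoduleZ12.obj n),
        ∀ e : Strip.BCell n, ((b e : Strip.submoduleZ12.obj n) : Strip.H1.obj (FI.of n)) = e.z) ∧
    Strip.submoduleZ12.toFIMod.IsFree ∧
    Nonempty (Strip.submoduleZ12.toFIMod ≅
      FI.free 2 (Representation.trivial ℚ (Equiv.Perm (Fin 2)) ℚ)) :=
  ⟨fun n _ => ⟨Strip.basisZ n, Strip.coe_basisZ⟩,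
    .of_iso Strip.freeIso.symm Strip.isFree_free_triv, ⟨Strip.freeIso.symm⟩⟩
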